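/- Let $\gamma$ be an oval of perimeter $L$: a smooth, simple closed, strictly convex plane curve with positive curvature $k$, oriented counterclockwise and parametrized by arc length (extended $L$-periodically to $\mathbb R$). Fix a radius $R$ that exceeds the curvature radius $1/k(s)$ of $\gamma$ at every point. For $s\in\mathbb R$ let $C_s$ be the circle of radius $R$, oriented counterclockwise, that is tangent to $\gamma$ at $\gamma(s)$ with agreeing orientation. A circumscribed curvilinear $q$-gon with rotation number $p$ is a closed curve composed of $q$ counterclockwise arcs, its sides. The sides correspond to lifted tangency parameters $(s_i)_{i\ge 0}$ with $0<s_{i+1}-s_i\le L$ and $s_{i+q}=s_i+pL$, and indices of sides are taken modulo $q$. The $i$-th side is an arc of $C_{s_i}$ that contains the tangency point $\gamma(s_i)$ in its interior, extends at most a half-circle backward and at most a half-circle forward from $\gamma(s_i)$, and ends where the $(i+1)$-st side begins. (For $q=p$ each side is a full circle.) Its area is $\frac12\oint (x\,dy-y\,dx)$, taken along the polygon; that is, the area it encloses, counted with multiplicity. Then for all integers $m\ge p\ge 1$ the areas of the circumscribed curvilinear $m$-gons with rotation number $p$ attain a minimum $N_{p,m}$, and for all integers $1\le p<q$ $$N_{p,q-1}+N_{p,q+1}>2N_{p,q}.$$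 -/

import Mathlib

open scoped ContDiff

noncomputable section

/-- The standard area form (determinant) on the Euclidean plane `ℂ = ℝ²`. -/
def cross (z w : ℂ) : ℝ := z.re * w.im - z.im * w.re

/-- The signed curvature of a plane curve parametrized by arc length. -/
def curvature (γ : ℝ → ℂ) (s : ℝ) : ℝ := cross (deriv γ s) (deriv (deriv γ) s)

/-- `γ` is an oval of perimeter `L`: a smooth simple closed plane curve, parametrized by arc
length and oriented counterclockwise, which is strictly convex (except for the point of tangency,
it lies strictly to the left of each of its oriented tangent lines) and has positive curvature. -/
structure IsOval (γ : ℝ → ℂ) (L : ℝ) : Prop where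
  length_pos : 0 < L
  smooth : ContDiff ℝ ∞ γ
  periodic : Function.Periodic γ L
  unit_speed : ∀ s, ‖deriv γ s‖ = 1
  simple : ∀ s t, γ s = γ t → ∃ n : ℤ, t = s + n * L
  strictly_convex : ∀ s t, γ t ≠ γ s → 0 < cross (deriv γ s) (γ t - γ s)
  curvature_pos : ∀ s, 0 < curvature γ s

/-- The center of the circle of radius `R` that is tangent to `γ` at `γ s` and whose
counterclockwise orientation agrees there with the orientation of `γ`. -/
def larmorCenter (γ : ℝ → ℂ) (R s : ℝ) : ℂ := γ s + R * (Complex.I * deriv γ s)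

/-- The point of this circle reached from the tangency point `γ s` by turning counterclockwise
through the angle `φ` about the center. Thus `0 < φ ≤ π` describes the forward half-circle and
`-π ≤ φ < 0` the backward half-circle. -/
def larmorPoint (γ : ℝ → ℂ) (R s φ : ℝ) : ℂ :=
  larmorCenter γ R s + Complex.exp (φ * Complex.I) * (γ s - larmorCenter γ R s)

/-- A curvilinear `q`-gon with rotation number `p` circumscribed about `γ`, with sides of
radius `R`. The `i`-th side is the counterclockwise arc of the circle of radius `R` tangent to `γ`
at `γ (s i)` that begins at angle `b i` before the tangency point, in the backward half-circle, and
ends at angle `a i` after it, in the forward half-circle. It ends where the next side begins. The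
indices are cyclic modulo `q`; the tangency points are lifted to the universal cover `ℝ` of the
curve, each of them follows the previous one by at most one turn around `γ`, and over `q` steps
they make `p` turns. -/
structure CircumscribedPolygon (γ : ℝ → ℂ) (L R : ℝ) (p q : ℕ) where
  s : ℕ → ℝ
  a : ℕ → ℝ
  b : ℕ → ℝ
  s_lt : ∀ i, s i < s (i + 1)
  s_le : ∀ i, s (i + 1) ≤ s i + L
  s_add : ∀ i, s (i + q) = s i + p * L
  a_mem : ∀ i, a i ∈ Set.Ioc 0 Real.pi
  b_mem : ∀ i, b i ∈ Set.Ioc 0 Real.pi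
  a_add : ∀ i, a (i + q) = a i
  b_add : ∀ i, b (i + q) = b i
  vertex : ∀ i, larmorPoint γ R (s i) (a i) = larmorPoint γ R (s (i + 1)) (-b (i + 1))

/-- The area bounded by the polygon, `½ ∮ (x dy - y dx)` along its boundary: regions are counted
with multiplicity, namely the winding number of the boundary. -/
def CircumscribedPolygon.area {γ : ℝ → ℂ} {L R : ℝ} {p q : ℕ}
    (P : CircumscribedPolygon γ L R p q) : ℝ :=
  ∑ i ∈ Finset.range q, ∫ φ in (-P.b i)..(P.a i),
    (1 / 2) * cross (larmorPoint γ R (P.s i) φ) (deriv (larmorPoint γ R (P.s i)) φ)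

/-- The set of areas of circumscribed curvilinear `q`-gons with rotation number `p`. -/
def circumscribedAreas (γ : ℝ → ℂ) (L R : ℝ) (p q : ℕ) : Set ℝ :=
  Set.range fun P : CircumscribedPolygon γ L R p q => P.area

/-- `N_{p,q}`: the minimal area of circumscribed curvilinear `q`-gons with rotation number `p`. -/
def minCircumscribedArea (γ : ℝ → ℂ) (L R : ℝ) (p q : ℕ) : ℝ :=
  sInf (circumscribedAreas γ L R p q)

end

/-! Two tangency points at most one turn apart determine the vertex between their sides
(`IsOval.exists_vertex`). Regrouping the boundary integral by vertices therefore writes the area as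
the sum of `H (s i) (s (i + 1))` with `H = vertexArea γ R` (`CircumscribedPolygon.area_eq`). The
problem becomes one about minimal cycles of a discrete action, as in Aubry–Mather theory.

The geometric input is the twist condition that the mixed derivative of `H` is negative. The mixed
derivative factors (`mixed_derivative_eq`), and the signs of the factors follow because each circle
encloses the oval (`IsOval.normSq_sub_larmorCenter_lt`). Integrated, the condition is strict
submodularity: exchanging the endpoints of two nested steps lowers the cost.

Let `x` and `y` be minimal cycles with `q - 1` and `q + 1` points and `p` turns each. Since `x`
advances faster, some step of `y` is nested in a step of `x` (`exists_nested_step`). Exchanging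
endpoints there splices `x` and `y` into one cycle with `2 * q` points and `2 * p` turns
(`exists_splice`), at a strictly lower cost. If the nested steps share their initial point, the
exchange alone gains nothing. That point is then optimal between its neighbours in `y`, so by the
twist condition it is not optimal in the spliced cycle and can be moved with a gain.

Such a double cycle costs at least twice the minimum (`IsMinCycle.two_mul_cost_le`): the termwise
minimum and maximum of it and its translate by `q` places are two cycles of `q` points with no
larger total cost. -/

noncomputable section

/-! ### Minimal cycles of an abstract twist cost -/

/-- A two-point cost on the universal cover of a circle of length `L` which is strictly
submodular on steps of length at most `L`. The fields `decrease_of_full_step` and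
`decrease_of_ne` are the consequences of the twist condition for first variations. -/
structure IsTwistCost (H : ℝ → ℝ → ℝ) (L : ℝ) : Prop where
  length_pos : 0 < L
  cont : Continuous fun x : ℝ × ℝ => H x.1 x.2
  shift : ∀ x y, H (x + L) (y + L) = H x y
  diag : ∀ x, H x x = 0
  submodular : ∀ s t s' t', s < t → t ≤ s' → s' < t' → t' ≤ s + L →
    H s s' + H t t' < H s t' + H t s'
  decrease_of_full_step : ∀ s v, s < v → v < s + L →
    ∃ u, v < u ∧ u ≤ s + L ∧ u ≤ v + L ∧ H s u + H u (v + L) < H s v + H v (v + L)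
  decrease_of_ne : ∀ s v y x, s < v → v < s + L → v < y → y < x → x ≤ v + L →
    (∃ u, v < u ∧ u ≤ s + L ∧ u ≤ x ∧ H s u + H u x < H s v + H v x) ∨
    (∃ u, s < u ∧ u < v ∧ y ≤ u + L ∧ H s u + H u y < H s v + H v y)

/-- A lifted cyclic sequence of `m` points making `p` turns, with steps in `[0, L]`. -/
def IsCycle (L : ℝ) (p m : ℕ) (v : ℕ → ℝ) : Prop :=
  (∀ j, v j ≤ v (j + 1) ∧ v (j + 1) ≤ v j + L) ∧ ∀ j, v (j + m) = v j + p * L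

/-- The total cost of a cycle. -/
def cycleCost (H : ℝ → ℝ → ℝ) (m : ℕ) (v : ℕ → ℝ) : ℝ :=
  ∑ j ∈ Finset.range m, H (v j) (v (j + 1))

/-- A cycle of minimal cost. -/
def IsMinCycle (H : ℝ → ℝ → ℝ) (L : ℝ) (p m : ℕ) (v : ℕ → ℝ) : Prop :=
  IsCycle L p m v ∧ ∀ w, IsCycle L p m w → cycleCost H m v ≤ cycleCost H m w

section Cycles

variable {H : ℝ → ℝ → ℝ} {L : ℝ} {p m : ℕ} {v : ℕ → ℝ}

theorem IsTwistCost.shift_nat (hH : IsTwistCost H L) (n : ℕ) (x y : ℝ) :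
    H (x + n * L) (y + n * L) = H x y := by
  induction n with
  | zero => simp
  | succ n ih =>
    rw [← ih, ← hH.shift (x + n * L)]
    congr 1 <;> push_cast <;> ring

theorem IsCycle.comp_add (hv : IsCycle L p m v) (k : ℕ) :
    IsCycle L p m fun j => v (j + k) := by
  refine ⟨fun j => ?_, fun j => ?_⟩
  · have := hv.1 (j + k)
    rwa [add_right_comm] at this
  · have := hv.2 (j + k)
    rwa [add_right_comm] at this

theorem IsCycle.add_mul (hv : IsCycle L p m v) (j k : ℕ) :
    v (j + k * m) = v j + k * (p * L) := by
  induction k with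
  | zero => simp
  | succ k ih =>
    rw [Nat.succ_mul, ← add_assoc, hv.2, ih]; push_cast; ring

theorem sum_range_add_periodic {f : ℕ → ℝ} {m : ℕ} (hf : ∀ j, f (j + m) = f j) (k : ℕ) :
    ∑ j ∈ Finset.range m, f (j + k) = ∑ j ∈ Finset.range m, f j := by
  induction k with
  | zero => simp
  | succ k ih =>
    have h1 := Finset.sum_range_succ (fun j => f (j + k)) m
    have h2 := Finset.sum_range_succ' (fun j => f (j + k)) m
    have h3 : ∀ j, f (j + 1 + k) = f (j + (k + 1)) := fun j => by congr 1; ring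
    have h4 : f (m + k) = f (0 + k) := by rw [zero_add, add_comm, hf]
    simp only [h3, h4] at h1 h2
    linarith

theorem IsCycle.cost_comp_add (hH : IsTwistCost H L) (hv : IsCycle L p m v) (k : ℕ) :
    cycleCost H m (fun j => v (j + k)) = cycleCost H m v := by
  have := sum_range_add_periodic (f := fun j => H (v j) (v (j + 1))) (m := m)
    (fun j => by
      have h1 := hv.2 j
      have h2 := hv.2 (j + 1)
      rw [add_right_comm] at h2
      simp only [h1, h2, hH.shift_nat]) k
  unfold cycleCost
  rw [← this]
  refine Finset.sum_congr rfl fun j _ => ?_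
  simp only [add_right_comm]

theorem IsMinCycle.comp_add (hH : IsTwistCost H L) (hv : IsMinCycle H L p m v) (k : ℕ) :
    IsMinCycle H L p m fun j => v (j + k) :=
  ⟨hv.1.comp_add k, fun w hw => by rw [hv.1.cost_comp_add hH]; exact hv.2 w hw⟩

/-- Lets a competitor be prescribed on `0, …, m` only; each further period adds `p * L`. -/
theorem exists_isCycle_of_window (hm : 0 < m) (u : ℕ → ℝ)
    (hstep : ∀ j < m, u j ≤ u (j + 1) ∧ u (j + 1) ≤ u j + L) (hclose : u m = u 0 + p * L) :
    ∃ v, IsCycle L p m v ∧ (∀ j ≤ m, v j = u j) := by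
  have key : ∀ r k, r < m → u ((r + m * k) % m) + ((r + m * k) / m : ℕ) * (p * L)
      = u r + k * (p * L) := by
    intro r k hr
    rw [Nat.add_mul_mod_self_left, Nat.mod_eq_of_lt hr, Nat.add_mul_div_left _ _ hm,
      Nat.div_eq_of_lt hr, zero_add]
  have key' : ∀ r k, r ≤ m → u ((r + m * k) % m) + ((r + m * k) / m : ℕ) * (p * L)
      = u r + k * (p * L) := by
    intro r k hr
    rcases hr.lt_or_eq with h | rfl
    · exact key r k h
    · have := key 0 (k + 1) hm
      rw [show 0 + r * (k + 1) = r + r * k by ring] at this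
      rw [this, hclose]; push_cast; ring
  refine ⟨fun j => u (j % m) + (j / m : ℕ) * (p * L), ⟨fun j => ?_, fun j => ?_⟩, fun j hj => ?_⟩
  · obtain ⟨r, k, hr, rfl⟩ : ∃ r k, r < m ∧ j = r + m * k :=
      ⟨j % m, j / m, Nat.mod_lt _ hm, (Nat.mod_add_div j m).symm⟩
    have h1 := key r k hr
    have h2 := key' (r + 1) k hr
    rw [show r + 1 + m * k = r + m * k + 1 by ring] at h2
    simp only [h1, h2]
    have := hstep r hr
    constructor <;> linarith [this.1, this.2]
  · simp only [Nat.add_mod_right, Nat.add_div_right _ hm]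
    push_cast; ring
  · simpa using key' j 0 hj

theorem cycleCost_congr {u w : ℕ → ℝ} (h : ∀ j ≤ m, w j = u j) :
    cycleCost H m w = cycleCost H m u :=
  Finset.sum_congr rfl fun j hj => by
    rw [h j (Finset.mem_range.1 hj).le, h (j + 1) (Finset.mem_range.1 hj)]

/-- Admitting zero steps keeps the constraints closed. A shift by a multiple of `L` puts the initial
point in `[0, L]`, which bounds the whole window. Entries past `m` do not enter the cost and are
only kept in the box, so that Tychonoff applies. -/
theorem exists_isMinCycle (hH : IsTwistCost H L) (hp : 1 ≤ p) (hpm : p ≤ m) :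
    ∃ v, IsMinCycle H L p m v := by
  have hL := hH.length_pos
  have hm : 0 < m := by omega
  set K : Set (ℕ → ℝ) := {u | (u 0 ∈ Set.Icc 0 L ∧ u m = u 0 + p * L) ∧
    ∀ j, u j ∈ Set.Icc 0 ((p + 1) * L) ∧ (j < m → u j ≤ u (j + 1) ∧ u (j + 1) ≤ u j + L)} with hK
  have hmono : ∀ w, IsCycle L p m w → Monotone w := fun w hw => monotone_nat_of_le_succ
    fun j => (hw.1 j).1
  have hKc : IsCompact K := by
    refine (isCompact_univ_pi (s := fun _ : ℕ => Set.Icc (0 : ℝ) ((p + 1) * L))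
      fun _ => isCompact_Icc).of_isClosed_subset ?_ fun u hu j _ => (hu.2 j).1
    have hKeq : K = ({u | u 0 ∈ Set.Icc 0 L} ∩ {u | u m = u 0 + p * L}) ∩
        ⋂ j, ({u | u j ∈ Set.Icc 0 ((p + 1) * L)} ∩
          {u | j < m → u j ≤ u (j + 1) ∧ u (j + 1) ≤ u j + L}) := by
      ext u; simp [hK]
    rw [hKeq]
    refine IsClosed.inter (IsClosed.inter ?_ ?_) (isClosed_iInter fun j => IsClosed.inter ?_ ?_)
    · exact isClosed_Icc.preimage (continuous_apply 0)
    · exact isClosed_eq (by fun_prop) (by fun_prop)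
    · exact isClosed_Icc.preimage (continuous_apply j)
    · by_cases h : j < m
      · simp only [h, true_implies]
        exact (isClosed_le (continuous_apply j) (continuous_apply (j + 1))).inter
          (isClosed_le (continuous_apply (j + 1)) ((continuous_apply j).add continuous_const))
      · simp [h]
  have hfrom : ∀ w, IsCycle L p m w → ∃ u ∈ K, cycleCost H m u = cycleCost H m w := by
    intro w hw
    obtain ⟨n, hn⟩ : ∃ n : ℤ, w 0 + n * L ∈ Set.Icc 0 L := by
      refine ⟨-⌊w 0 / L⌋, ?_⟩
      have h1 := Int.floor_le (w 0 / L)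
      have h2 := Int.lt_floor_add_one (w 0 / L)
      rw [le_div_iff₀ hL] at h1
      rw [div_lt_iff₀ hL] at h2
      push_cast
      constructor <;> linarith
    have hsh : ∀ x y, H (x + n * L) (y + n * L) = H x y := by
      intro x y
      obtain ⟨k, rfl | rfl⟩ := n.eq_nat_or_neg
      · exact_mod_cast hH.shift_nat k x y
      · rw [← hH.shift_nat k]; push_cast; ring_nf
    refine ⟨fun j => if j ≤ m then w j + n * L else w m + n * L, ⟨⟨by simpa using hn, ?_⟩, ?_⟩, ?_⟩
    · have := hw.2 0
      simp only [zero_add] at this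
      simp only [le_refl, if_true, zero_le, this]; ring
    · intro j
      have hwm := hw.2 0
      simp only [zero_add] at hwm
      have hb : ∀ i ≤ m, w i + n * L ∈ Set.Icc 0 ((p + 1) * L) := fun i hi =>
        ⟨by linarith [hn.1, hmono w hw (Nat.zero_le i)],
          by linarith [hn.2, hmono w hw hi]⟩
      refine ⟨?_, fun hj => ?_⟩
      · by_cases h : j ≤ m
        · simpa only [h, if_true] using hb j h
        · simpa only [h, if_false] using hb m le_rfl
      · simp only [hj.le, Nat.succ_le_of_lt hj, if_true]
        have := hw.1 j
        constructor <;> linarith [this.1, this.2]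
    · refine Finset.sum_congr rfl fun j hj => ?_
      have hj := Finset.mem_range.1 hj
      simp only [hj.le, Nat.succ_le_of_lt hj, if_true, hsh]
  have hne : K.Nonempty := by
    have hmR : (0 : ℝ) < m := by exact_mod_cast hm
    have hpR : (p : ℝ) ≤ m := by exact_mod_cast hpm
    have hcyc : IsCycle L p m fun j => j * (p * L / m) := by
      refine ⟨fun j => ?_, fun j => ?_⟩
      · have h1 : 0 ≤ p * L / m := by positivity
        have h2 : p * L / m ≤ L := by
          rw [div_le_iff₀ hmR]; nlinarith
        push_cast
        constructor <;> linarith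
      · push_cast; field_simp
    obtain ⟨u, hu, -⟩ := hfrom _ hcyc
    exact ⟨u, hu⟩
  have hcont : Continuous fun u : ℕ → ℝ => cycleCost H m u :=
    continuous_finsetSum _ fun j _ => by
      have h2 : Continuous fun u : ℕ → ℝ => (u j, u (j + 1)) := by fun_prop
      exact hH.cont.comp h2
  obtain ⟨u, huK, hu⟩ := hKc.exists_isMinOn hne hcont.continuousOn
  obtain ⟨v, hv, hvu⟩ := exists_isCycle_of_window (L := L) (p := p) hm u
    (fun j hj => (huK.2 j).2 hj) huK.1.2
  refine ⟨v, hv, fun w hw => ?_⟩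
  obtain ⟨u', hu', hc⟩ := hfrom w hw
  rw [← hc, cycleCost_congr hvu]
  exact hu hu'

theorem IsMinCycle.two_step_le (hH : IsTwistCost H L) (hm : 2 ≤ m) (hv : IsMinCycle H L p m v)
    (i : ℕ) {u : ℝ} (h1 : v i ≤ u) (h2 : u ≤ v i + L) (h3 : u ≤ v (i + 2))
    (h4 : v (i + 2) ≤ u + L) :
    H (v i) (v (i + 1)) + H (v (i + 1)) (v (i + 2)) ≤ H (v i) u + H u (v (i + 2)) := by
  wlog hi : i = 0 generalizing v i
  · have := this (hv.comp_add hH i) 0 (by simpa using h1) (by simpa using h2)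
      (by simpa [add_comm] using h3) (by simpa [add_comm] using h4) rfl
    simpa [add_comm] using this
  subst hi
  simp only [zero_add] at *
  obtain ⟨n, rfl⟩ : ∃ n, m = n + 2 := ⟨m - 2, by omega⟩
  obtain ⟨w, hw, hwu⟩ := exists_isCycle_of_window (L := L) (p := p) (m := n + 2) (by omega)
    (Function.update v 1 u) (fun j hj => by
      rcases j with _ | _ | j
      · simp [h1, h2]
      · simpa using ⟨h3, h4⟩
      · simpa [Function.update] using hv.1.1 (j + 2)) (by
      have := hv.1.2 0
      simpa [Function.update] using this)
  have := hv.2 w hw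
  rw [cycleCost_congr hwu] at this
  unfold cycleCost at this
  rw [Finset.sum_range_succ', Finset.sum_range_succ', Finset.sum_range_succ',
    Finset.sum_range_succ'] at this
  simp [Function.update] at this
  linarith

theorem exists_and_not_succ {P : ℕ → Prop} {i k : ℕ} (hik : i ≤ k) (hi : P i) (hk : ¬ P k) :
    ∃ j, P j ∧ ¬ P (j + 1) := by
  by_contra! h
  exact hk (Nat.le_induction hi (fun n _ hn => h n hn) k hik)

theorem IsCycle.exists_lt_succ (hL : 0 < L) (hp : 1 ≤ p) (hv : IsCycle L p m v) :
    ∃ i, v i < v (i + 1) := by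
  by_contra! h
  have hc : ∀ j, v j ≤ v 0 := fun j => by
    induction j with
    | zero => rfl
    | succ j ih => exact (h j).trans ih
  have h1 := hv.2 0
  have h2 := hc (0 + m)
  have : (1 : ℝ) ≤ p := by exact_mod_cast hp
  nlinarith

theorem IsCycle.exists_succ_lt_add (hL : 0 < L) (hpm : p < m) (hv : IsCycle L p m v) :
    ∃ i, v (i + 1) < v i + L := by
  by_contra! h
  have hc : ∀ j : ℕ, v 0 + j * L ≤ v j := fun j => by
    induction j with
    | zero => simp
    | succ j ih => have := h j; push_cast; linarith
  have h1 := hv.2 0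
  have h2 := hc m
  rw [zero_add] at h1
  have : (p : ℝ) < m := by exact_mod_cast hpm
  nlinarith

/-- Not all steps vanish, so a zero step would yield a positive step followed by a zero one. As `H`
vanishes on the diagonal, submodularity with equal middle arguments shows that moving the repeated
point to the midpoint is a strict gain. -/
theorem IsMinCycle.lt_succ (hH : IsTwistCost H L) (hp : 1 ≤ p) (hpm : p ≤ m)
    (hv : IsMinCycle H L p m v) (j : ℕ) : v j < v (j + 1) := by
  by_contra hj
  obtain ⟨i, hi⟩ := hv.1.exists_lt_succ hH.length_pos hp
  have hm : 0 < m := by omega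
  obtain ⟨k, hk, hk'⟩ := exists_and_not_succ (P := fun i => v i < v (i + 1)) (i := i)
    (k := j + i * m) (by nlinarith) hi (by
      rw [add_right_comm, hv.1.add_mul, hv.1.add_mul]
      simpa using hj)
  have he : v (k + 2) = v (k + 1) := le_antisymm (not_lt.1 hk') (hv.1.1 _).1
  have hm2 : 2 ≤ m := by
    by_contra hlt
    obtain rfl : m = 1 := by omega
    have h1 := hv.1.2 k
    have h2 := hv.1.2 (k + 1)
    rw [add_assoc] at h2
    norm_num at h2
    linarith
  have hs := (hv.1.1 k).2
  set u := (v k + v (k + 1)) / 2 with hu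
  have h := hv.two_step_le hH hm2 k (u := u) (by linarith) (by linarith) (by linarith)
    (by linarith)
  have h' := hH.submodular (v k) u u (v (k + 1)) (by linarith) le_rfl (by linarith) hs
  rw [he] at h
  simp only [hH.diag] at h h'
  linarith

/-- Since `p < m`, some step is shorter than `L`. A full step would yield a shorter step followed by
a full one, and `decrease_of_full_step` improves that pair. -/
theorem IsMinCycle.succ_lt_add (hH : IsTwistCost H L) (hp : 1 ≤ p) (hpm : p < m)
    (hv : IsMinCycle H L p m v) (j : ℕ) : v (j + 1) < v j + L := by
  by_contra hj
  obtain ⟨i, hi⟩ := hv.1.exists_succ_lt_add hH.length_pos hpm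
  have hm : 0 < m := by omega
  obtain ⟨k, hk, hk'⟩ := exists_and_not_succ (P := fun i => v (i + 1) < v i + L) (i := i)
    (k := j + i * m) (by nlinarith) hi (by
      rw [add_right_comm, hv.1.add_mul, hv.1.add_mul]
      intro h
      exact hj (by linarith))
  have he : v (k + 2) = v (k + 1) + L := le_antisymm (hv.1.1 _).2 (not_lt.1 hk')
  obtain ⟨u, h1, h2, h3, h4⟩ := hH.decrease_of_full_step (v k) (v (k + 1))
    (hv.lt_succ hH hp hpm.le k) hk
  have := hv.two_step_le hH (by omega) k (u := u) (by linarith [(hv.1.1 k).1]) h2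
    (by linarith) (by linarith)
  rw [he] at this
  linarith

/-- Only a change of order matters: then one step is nested in the other and submodularity applies.
Otherwise both sides agree. -/
theorem IsTwistCost.min_add_max_le (hH : IsTwistCost H L) {a a' b b' : ℝ} (ha : a ≤ a')
    (ha' : a' ≤ a + L) (hb : b ≤ b') (hb' : b' ≤ b + L) :
    H (min a b) (min a' b') + H (max a b) (max a' b') ≤ H a a' + H b b' := by
  wlog hab : a ≤ b generalizing a a' b b'
  · have := this hb hb' ha ha' (le_of_not_ge hab)
    rw [min_comm b, min_comm b', max_comm b, max_comm b'] at this
    linarith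
  rw [min_eq_left hab, max_eq_right hab]
  rcases le_or_gt a' b' with h | h
  · rw [min_eq_left h, max_eq_right h]
  · rw [min_eq_right h.le, max_eq_left h.le]
    rcases hab.lt_or_eq with h' | rfl
    · exact (hH.submodular a b b' a' h' hb h ha').le
    · linarith

/-- Translating `z` by `m` places and `p` turns back is an involution, so it swaps the two sequences
being compared. Their minimum and maximum are therefore cycles of `m` points. -/
theorem IsMinCycle.two_mul_cost_le (hH : IsTwistCost H L) (hv : IsMinCycle H L p m v)
    {z : ℕ → ℝ} (hz : IsCycle L (2 * p) (2 * m) z) :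
    2 * cycleCost H m v ≤ cycleCost H (2 * m) z := by
  have hs : ∀ j, z (j + m + m) = z j + 2 * p * L := fun j => by
    have := hz.2 j
    rw [add_assoc, ← two_mul, this]; push_cast; ring
  have hstep : ∀ j, z (j + m) ≤ z (j + 1 + m) ∧ z (j + 1 + m) ≤ z (j + m) + L := fun j => by
    have := hz.1 (j + m)
    rwa [add_right_comm] at this
  have h1 := hv.2 (fun j => min (z j) (z (j + m) - p * L)) ⟨fun j => ⟨?_, ?_⟩, fun j => ?_⟩
  have h2 := hv.2 (fun j => max (z j) (z (j + m) - p * L)) ⟨fun j => ⟨?_, ?_⟩, fun j => ?_⟩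
  · have h3 : cycleCost H (2 * m) z =
        ∑ j ∈ Finset.range m, (H (z j) (z (j + 1)) + H (z (j + m)) (z (j + 1 + m))) := by
      rw [Finset.sum_add_distrib, cycleCost, two_mul, Finset.sum_range_add]
      congr 1
      refine Finset.sum_congr rfl fun j _ => ?_
      congr 2 <;> ring
    have h4 : cycleCost H m (fun j => min (z j) (z (j + m) - p * L)) +
        cycleCost H m (fun j => max (z j) (z (j + m) - p * L)) ≤ cycleCost H (2 * m) z := by
      rw [h3, cycleCost, cycleCost, ← Finset.sum_add_distrib]
      refine Finset.sum_le_sum fun j _ => ?_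
      have h5 := hH.min_add_max_le (a := z j) (a' := z (j + 1)) (b := z (j + m) - p * L)
        (b' := z (j + 1 + m) - p * L) (hz.1 j).1 (hz.1 j).2 (by linarith [(hstep j).1])
        (by linarith [(hstep j).2])
      have h6 := hH.shift_nat p (z (j + m) - p * L) (z (j + 1 + m) - p * L)
      simp only [sub_add_cancel] at h6
      linarith
    linarith
  · exact max_le_max (hz.1 j).1 (by linarith [(hstep j).1])
  · rw [← max_add_add_right]
    exact max_le_max (hz.1 j).2 (by linarith [(hstep j).2])
  · simp only [hs]
    rw [← max_add_add_right, max_comm]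
    congr 1 <;> ring
  · exact min_le_min (hz.1 j).1 (by linarith [(hstep j).1])
  · rw [← min_add_add_right]
    exact min_le_min (hz.1 j).2 (by linarith [(hstep j).2])
  · simp only [hs]
    rw [← min_add_add_right, min_comm]
    congr 1 <;> ring

end Cycles

/-! ### Splicing two minimal cycles -/

section Interlacing

variable {H : ℝ → ℝ → ℝ} {L : ℝ} {p q : ℕ}

/-- Two cycles with the same number of turns but different numbers of points contain, after a
shift, a step of the finer one nested inside a step of the coarser one. -/
theorem exists_nested_step (hL : 0 < L) (hp : 1 ≤ p) {x y : ℕ → ℝ} {m n : ℕ} (hmn : m < n)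
    (hx : IsCycle L p m x) (hy : IsCycle L p n y) :
    ∃ i j, x i ≤ y j ∧ y (j + 1) < x (i + 1) := by
  have hpL : 0 < p * L := by positivity
  obtain ⟨k, hk⟩ := exists_nat_ge ((x 0 - y 0) / (p * L))
  rw [div_le_iff₀ hpL] at hk
  have h0 : x 0 ≤ y (0 + k * n) := by rw [hy.add_mul]; linarith
  obtain ⟨l, hl⟩ := exists_nat_gt ((y (0 + k * n) - x 0) / (p * L))
  rw [div_lt_iff₀ hpL] at hl
  -- Over `l * m * n` indices `x` advances by `l * n` periods and `y` only by `l * m`, so the head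
  -- start of `y` is lost.
  have h1 : ¬ x (0 + l * m * n) ≤ y (0 + l * m * n + k * n) := by
    rw [show l * m * n = (l * n) * m by ring, hx.add_mul,
      show 0 + l * n * m + k * n = 0 + k * n + (l * m) * n by ring, hy.add_mul]
    have : (m : ℝ) + 1 ≤ n := by exact_mod_cast hmn
    have hl0 : (0 : ℝ) ≤ l := by positivity
    push_cast
    nlinarith [mul_le_mul_of_nonneg_left this (mul_nonneg hl0 hpL.le)]
  obtain ⟨j, hj, hj'⟩ := exists_and_not_succ (P := fun j => x j ≤ y (j + k * n)) (i := 0)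
    (Nat.zero_le _) (by simpa using h0) h1
  refine ⟨j, j + k * n, hj, ?_⟩
  rw [add_right_comm]
  exact not_le.1 hj'

/-- Splicing two cycles at a common place, with one point of the second cycle replaced by `u`. -/
theorem exists_splice (hH : IsTwistCost H L) {x y : ℕ → ℝ} {m n : ℕ} (hm : 1 ≤ m) (hn : 2 ≤ n)
    (hx : IsCycle L p m x) (hy : IsCycle L p n y) {s u : ℝ} (hs : y (n - 1) = s + p * L)
    (h1 : s ≤ u) (h2 : u ≤ s + L) (h3 : u ≤ x 1) (h4 : x 1 ≤ u + L) (h5 : x 0 ≤ y 1)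
    (h6 : y 1 ≤ x 0 + L) :
    ∃ z, IsCycle L (2 * p) (m + n) z ∧ cycleCost H (m + n) z =
      cycleCost H m x + cycleCost H n y - H (x 0) (x 1) - H s (y 0) - H (y 0) (y 1) +
        H (x 0) (y 1) + H s u + H u (x 1) := by
  obtain ⟨m, rfl⟩ : ∃ k, m = k + 1 := ⟨m - 1, by omega⟩
  obtain ⟨n, rfl⟩ : ∃ k, n = k + 2 := ⟨n - 2, by omega⟩
  replace hs : y (n + 1) = s + p * L := hs
  -- The window reads `x 1, …, x (m + 1) = x 0 + p * L`, then `y 1, …, y (n + 1)` raised by `p * L`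
  -- and so ending at `s + 2 * p * L`, then `u` and `x 1` raised by `2 * p * L`.
  set w : ℕ → ℝ := fun j => if j ≤ m then x (j + 1) else
    if j ≤ m + n + 1 then y (j - m) + p * L else
    if j = m + n + 2 then u + 2 * p * L else x 1 + 2 * p * L with hw
  have hw1 : ∀ j ≤ m, w j = x (j + 1) := fun j hj => by simp [hw, hj]
  have hw2 : ∀ j ≤ n, w (m + 1 + j) = y (j + 1) + p * L := fun j hj => by
    simp only [hw]
    rw [if_neg (by omega), if_pos (by omega)]
    congr 2; omega
  have hw3 : w (m + 1 + (n + 1)) = u + 2 * p * L := by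
    simp only [hw]
    rw [if_neg (by omega), if_neg (by omega), if_pos (by omega)]
  have hw4 : w (m + 1 + (n + 2)) = x 1 + 2 * p * L := by
    simp only [hw]
    rw [if_neg (by omega), if_neg (by omega), if_neg (by omega)]
  have hxm : x (m + 1) = x 0 + p * L := by simpa using hx.2 0
  have hyn : y (n + 2) = y 0 + p * L := by simpa using hy.2 0
  obtain ⟨z, hz, hzw⟩ := exists_isCycle_of_window (L := L) (p := 2 * p) (m := m + 1 + (n + 2))
    (by omega) w (fun j hj => by
      rcases lt_trichotomy j m with h | rfl | h
      · rw [hw1 j h.le, hw1 (j + 1) h]; exact hx.1 (j + 1)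
      · rw [hw1 j le_rfl, hxm, show j + 1 = j + 1 + 0 by ring, hw2 0 (Nat.zero_le _)]
        constructor <;> simp only [zero_add] <;> linarith
      · obtain ⟨k, rfl⟩ : ∃ k, j = m + 1 + k := ⟨j - (m + 1), by omega⟩
        rcases lt_trichotomy k n with h' | rfl | h'
        · rw [hw2 k h'.le, add_assoc, hw2 (k + 1) h']
          have := hy.1 (k + 1)
          constructor <;> linarith [this.1, this.2]
        · rw [hw2 k le_rfl, add_assoc, hw3, hs]
          constructor <;> linarith
        · obtain rfl : k = n + 1 := by omega
          rw [hw3, add_assoc, hw4]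
          constructor <;> linarith) (by
      rw [hw4, hw1 0 (Nat.zero_le _)]; push_cast; rfl)
  refine ⟨z, hz, ?_⟩
  rw [cycleCost_congr hzw]
  unfold cycleCost
  have hsh2 := hH.shift_nat (2 * p)
  push_cast at hsh2
  rw [Finset.sum_range_add, Finset.sum_range_succ, Finset.sum_range_succ _ (n + 1),
    Finset.sum_range_succ _ n, Finset.sum_range_succ' _ m, Finset.sum_range_succ' _ (n + 1),
    Finset.sum_range_succ _ n]
  have e1 : ∑ j ∈ Finset.range m, H (w j) (w (j + 1)) =
      ∑ j ∈ Finset.range m, H (x (j + 1)) (x (j + 1 + 1)) :=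
    Finset.sum_congr rfl fun j hj => by
      have := Finset.mem_range.1 hj
      rw [hw1 j this.le, hw1 (j + 1) this]
  have e2 : ∑ j ∈ Finset.range n, H (w (m + 1 + j)) (w (m + 1 + j + 1)) =
      ∑ j ∈ Finset.range n, H (y (j + 1)) (y (j + 1 + 1)) :=
    Finset.sum_congr rfl fun j hj => by
      have := Finset.mem_range.1 hj
      rw [hw2 j this.le, add_assoc, hw2 (j + 1) this, hH.shift_nat]
  have e3 : H (w m) (w (m + 1)) = H (x 0) (y 1) := by
    rw [hw1 m le_rfl, hxm, show m + 1 = m + 1 + 0 by ring, hw2 0 (Nat.zero_le _), hH.shift_nat]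
  have e4 : H (w (m + 1 + n)) (w (m + 1 + n + 1)) = H s u := by
    rw [hw2 n le_rfl, add_assoc, hw3, hs, ← hsh2 s u]; congr 1; ring
  have e5 : H (w (m + 1 + (n + 1))) (w (m + 1 + (n + 1) + 1)) = H u (x 1) := by
    rw [hw3, add_assoc, hw4, hsh2]
  have e6 : H (y (n + 1)) (y (n + 1 + 1)) = H s (y 0) := by
    rw [hs, add_assoc, hyn, hH.shift_nat]
  rw [e1, e2, e3, e4, e5, e6]
  simp only [zero_add]
  ring

theorem IsTwistCost.two_mul_min_lt (hH : IsTwistCost H L) (hp : 1 ≤ p) (hpq : p < q)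
    {x y v : ℕ → ℝ} (hx : IsMinCycle H L p (q - 1) x) (hy : IsMinCycle H L p (q + 1) y)
    (hv : IsMinCycle H L p q v) :
    2 * cycleCost H q v < cycleCost H (q - 1) x + cycleCost H (q + 1) y := by
  obtain ⟨i, j, h1, h2⟩ := exists_nested_step hH.length_pos hp (by omega) hx.1 hy.1
  rw [← hx.1.cost_comp_add hH i, ← hy.1.cost_comp_add hH j]
  replace hx := hx.comp_add hH i
  replace hy := hy.comp_add hH j
  set x' := fun k => x (k + i) with hx'
  set y' := fun k => y (k + j) with hy'
  replace h1 : x' 0 ≤ y' 0 := by simpa [hx', hy'] using h1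
  replace h2 : y' 1 < x' 1 := by simpa [hx', hy', add_comm] using h2
  set s := y' q - p * L with hs
  have hyq : y' (q + 1) = y' 0 + p * L := by simpa using hy.1.2 0
  have hs0 : s < y' 0 := by linarith [hy.lt_succ hH hp (by omega) q]
  have hs1 : y' 0 < s + L := by linarith [hy.succ_lt_add hH hp (by omega) q]
  have hy1 : y' 0 < y' 1 := by simpa using hy.lt_succ hH hp (by omega) 0
  have hx1 : x' 1 ≤ x' 0 + L := by simpa using (hx.1.1 0).2
  have key : ∀ u, s ≤ u → u ≤ s + L → u ≤ x' 1 → x' 1 ≤ u + L → 2 * cycleCost H q v ≤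
      cycleCost H (q - 1) x' + cycleCost H (q + 1) y' - H (x' 0) (x' 1) - H s (y' 0)
        - H (y' 0) (y' 1) + H (x' 0) (y' 1) + H s u + H u (x' 1) := by
    intro u hu1 hu2 hu3 hu4
    obtain ⟨z, hz, hc⟩ := exists_splice hH (by omega) (by omega) hx.1 hy.1 (s := s) (u := u)
      (by simp [hs]) hu1 hu2 hu3 hu4 (by linarith) (by linarith)
    rw [show q - 1 + (q + 1) = 2 * q by omega] at hz hc
    rw [← hc]
    exact hv.two_mul_cost_le hH hz
  rcases h1.lt_or_eq with h1 | h1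
  -- Distinct initial points: the exchange itself gains, and `y' 0` stays in place.
  · have := key (y' 0) hs0.le hs1.le (by linarith) (by linarith)
    have := hH.submodular (x' 0) (y' 0) (y' 1) (x' 1) h1 hy1.le h2 hx1
    linarith
  · rw [h1] at key hx1
    rcases hH.decrease_of_ne s (y' 0) (y' 1) (x' 1) hs0 hs1 hy1 h2 hx1 with
      ⟨u, hu1, hu2, hu3, hu4⟩ | ⟨u, hu1, hu2, hu3, hu4⟩
    · have := key u (by linarith) hu2 hu3 (by linarith)
      linarith
    -- This alternative would improve `y'` itself at its point `y' 0`, seen one period later at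
    -- index `q + 1`.
    · exfalso
      have hyq2 : y' (q + 2) = y' 1 + p * L := by
        have := hy.1.2 1
        rwa [show 1 + (q + 1) = q + 2 by ring] at this
      have := hy.two_step_le hH (by omega) q (u := u + p * L) (by linarith) (by linarith)
        (by linarith) (by linarith)
      rw [hyq, hyq2, show y' q = s + p * L by rw [hs]; ring] at this
      simp only [hH.shift_nat] at this
      linarith

end Interlacing

/-! ### Plane vectors -/

/-- The Euclidean inner product on `ℂ = ℝ²`. -/
def dot (z w : ℂ) : ℝ := z.re * w.re + z.im * w.im

section PlaneVectors

variable {f g : ℝ → ℂ} {f' g' : ℂ} {x : ℝ}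

theorem HasDerivAt.re_comp (hf : HasDerivAt f f' x) : HasDerivAt (fun x => (f x).re) f'.re x :=
  Complex.reCLM.hasFDerivAt.comp_hasDerivAt x hf

theorem HasDerivAt.im_comp (hf : HasDerivAt f f' x) : HasDerivAt (fun x => (f x).im) f'.im x :=
  Complex.imCLM.hasFDerivAt.comp_hasDerivAt x hf

theorem HasDerivAt.cross (hf : HasDerivAt f f' x) (hg : HasDerivAt g g' x) :
    HasDerivAt (fun x => cross (f x) (g x)) (cross f' (g x) + cross (f x) g') x := by
  refine ((hf.re_comp.mul hg.im_comp).sub (hf.im_comp.mul hg.re_comp)).congr_deriv ?_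
  simp only [_root_.cross]; ring

theorem HasDerivAt.dot (hf : HasDerivAt f f' x) (hg : HasDerivAt g g' x) :
    HasDerivAt (fun x => dot (f x) (g x)) (dot f' (g x) + dot (f x) g') x := by
  refine ((hf.re_comp.mul hg.re_comp).add (hf.im_comp.mul hg.im_comp)).congr_deriv ?_
  simp only [_root_.dot]; ring

theorem dot_self_eq (z : ℂ) : dot z z = ‖z‖ ^ 2 := by
  rw [← Complex.normSq_eq_norm_sq, Complex.normSq_apply, dot]

theorem norm_eq_sqrt_dot (z : ℂ) : ‖z‖ = √(dot z z) := by
  rw [dot_self_eq, Real.sqrt_sq (norm_nonneg z)]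

theorem cross_exp (a b : ℝ) :
    cross (Complex.exp (a * Complex.I)) (Complex.exp (b * Complex.I)) = Real.sin (b - a) := by
  rw [cross, Complex.exp_ofReal_mul_I_re, Complex.exp_ofReal_mul_I_re,
    Complex.exp_ofReal_mul_I_im, Complex.exp_ofReal_mul_I_im, Real.sin_sub]
  ring

end PlaneVectors

/-! ### The tangent angle and the curve of centers -/

/-- The angle of the tangent vector of `γ`, as a continuous function of the arc length. -/
def tangentAngle (γ : ℝ → ℂ) (s : ℝ) : ℝ := (deriv γ 0).arg + ∫ t in (0 : ℝ)..s, curvature γ t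

section Oval

variable {γ : ℝ → ℂ} {L R : ℝ}

theorem IsOval.contDiff_deriv (hγ : IsOval γ L) : ContDiff ℝ ∞ (deriv γ) :=
  ((contDiff_infty_iff_deriv (𝕜 := ℝ)).1 hγ.smooth).2

theorem IsOval.hasDerivAt (hγ : IsOval γ L) (s : ℝ) : HasDerivAt γ (deriv γ s) s :=
  ((contDiff_infty_iff_deriv (𝕜 := ℝ)).1 hγ.smooth).1.differentiableAt.hasDerivAt

theorem IsOval.continuous_deriv (hγ : IsOval γ L) : Continuous (deriv γ) :=
  hγ.contDiff_deriv.continuous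

theorem IsOval.continuous_curvature (hγ : IsOval γ L) : Continuous (curvature γ) := by
  have h1 := hγ.continuous_deriv
  have h2 : Continuous (deriv (deriv γ)) :=
    ((contDiff_infty_iff_deriv (𝕜 := ℝ)).1 hγ.contDiff_deriv).2.continuous
  unfold curvature cross
  exact ((Complex.continuous_re.comp h1).mul (Complex.continuous_im.comp h2)).sub
    ((Complex.continuous_im.comp h1).mul (Complex.continuous_re.comp h2))

theorem IsOval.dot_tangent_self (hγ : IsOval γ L) (s : ℝ) :
    dot (deriv γ s) (deriv γ s) = 1 := by
  rw [dot_self_eq, hγ.unit_speed, one_pow]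

theorem IsOval.hasDerivAt_tangent (hγ : IsOval γ L) (s : ℝ) :
    HasDerivAt (deriv γ) (curvature γ s * (Complex.I * deriv γ s)) s := by
  have h : HasDerivAt (deriv γ) (deriv (deriv γ) s) s :=
    ((contDiff_infty_iff_deriv (𝕜 := ℝ)).1 hγ.contDiff_deriv).1.differentiableAt.hasDerivAt
  have h0 : dot (deriv (deriv γ) s) (deriv γ s) + dot (deriv γ s) (deriv (deriv γ) s) = 0 := by
    refine (h.dot h).unique ?_
    simp only [hγ.dot_tangent_self]
    exact hasDerivAt_const s 1
  have h1 := hγ.dot_tangent_self s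
  convert h using 1
  simp only [dot] at h0 h1
  apply Complex.ext
  · simp [curvature, cross]
    linear_combination (deriv (deriv γ) s).re * h1 - (deriv γ s).re / 2 * h0
  · simp [curvature, cross]
    linear_combination (deriv (deriv γ) s).im * h1 - (deriv γ s).im / 2 * h0

theorem IsOval.hasDerivAt_tangentAngle (hγ : IsOval γ L) (s : ℝ) :
    HasDerivAt (tangentAngle γ) (curvature γ s) s :=
  (hγ.continuous_curvature.integral_hasStrictDerivAt 0 s).hasDerivAt.const_add _

theorem IsOval.tangent_eq (hγ : IsOval γ L) (s : ℝ) :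
    deriv γ s = Complex.exp (tangentAngle γ s * Complex.I) := by
  set g : ℝ → ℂ := fun s => deriv γ s * Complex.exp (-(tangentAngle γ s * Complex.I)) with hg
  have hd : ∀ s, HasDerivAt g 0 s := fun s => by
    have h1 := ((hγ.hasDerivAt_tangentAngle s).ofReal_comp.mul_const Complex.I).neg.cexp
    refine ((hγ.hasDerivAt_tangent s).mul h1).congr_deriv ?_
    ring
  have hc : g s = g 0 := is_const_of_deriv_eq_zero (fun s => (hd s).differentiableAt)
    (fun s => (hd s).deriv) s 0
  have h0 : g 0 = 1 := by
    have h2 := Complex.norm_mul_exp_arg_mul_I (deriv γ 0)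
    rw [hγ.unit_speed, Complex.ofReal_one, one_mul] at h2
    simp only [hg, tangentAngle, intervalIntegral.integral_same, add_zero]
    nth_rewrite 1 [← h2]
    rw [← Complex.exp_add, add_neg_cancel, Complex.exp_zero]
  rw [h0] at hc
  simp only [hg, Complex.exp_neg] at hc
  rwa [mul_inv_eq_one₀ (Complex.exp_ne_zero _)] at hc

theorem IsOval.tangent_add (hγ : IsOval γ L) (s : ℝ) : deriv γ (s + L) = deriv γ s := by
  rw [← deriv_comp_add_const]
  congr 1
  exact funext hγ.periodic

theorem IsOval.strictMono_tangentAngle (hγ : IsOval γ L) : StrictMono (tangentAngle γ) :=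
  strictMono_of_deriv_pos fun s => by
    rw [(hγ.hasDerivAt_tangentAngle s).deriv]; exact hγ.curvature_pos s

theorem IsOval.continuous_tangentAngle (hγ : IsOval γ L) : Continuous (tangentAngle γ) :=
  continuous_iff_continuousAt.2 fun s => (hγ.hasDerivAt_tangentAngle s).continuousAt

theorem IsOval.ne_of_lt (hγ : IsOval γ L) {s t : ℝ} (h1 : s < t) (h2 : t < s + L) :
    γ t ≠ γ s := by
  intro h
  obtain ⟨n, hn⟩ := hγ.simple s t h.symm
  have hL := hγ.length_pos
  have h3 : (0 : ℝ) < n := by by_contra! hn'; nlinarith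
  have h4 : (n : ℝ) < 1 := by by_contra! hn'; nlinarith
  have h3' : 0 < n := by exact_mod_cast h3
  have h4' : n < 1 := by exact_mod_cast h4
  omega

theorem IsOval.tangent_ne (hγ : IsOval γ L) {s t : ℝ} (h1 : s < t) (h2 : t < s + L) :
    deriv γ t ≠ deriv γ s := by
  intro h
  have hne := hγ.ne_of_lt h1 h2
  have h3 := hγ.strictly_convex s t hne
  have h4 := hγ.strictly_convex t s hne.symm
  rw [h] at h4
  simp only [cross, Complex.sub_re, Complex.sub_im] at h3 h4
  linarith

/-- If the tangent turned more than once, two distinct points within a period would have equal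
oriented tangents. Each would lie strictly to the left of the tangent at the other, which is
impossible. -/
theorem IsOval.tangentAngle_add (hγ : IsOval γ L) (s : ℝ) :
    tangentAngle γ (s + L) = tangentAngle γ s + 2 * Real.pi := by
  have h := hγ.tangent_add s
  rw [hγ.tangent_eq, hγ.tangent_eq, Complex.exp_eq_exp_iff_exists_int] at h
  obtain ⟨n, hn⟩ := h
  have hn' : tangentAngle γ (s + L) = tangentAngle γ s + n * (2 * Real.pi) := by
    have h1 : ((tangentAngle γ (s + L) : ℝ) : ℂ) * Complex.I =
        ((tangentAngle γ s + n * (2 * Real.pi) : ℝ) : ℂ) * Complex.I := by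
      rw [hn]; push_cast; ring
    exact_mod_cast mul_right_cancel₀ Complex.I_ne_zero h1
  have hpi := Real.pi_pos
  have hlt := hγ.strictMono_tangentAngle (show s < s + L by linarith [hγ.length_pos])
  have h0 : 0 < n := by
    have : (0 : ℝ) < n := by by_contra! h'; nlinarith
    exact_mod_cast this
  rcases eq_or_ne n 1 with rfl | h1
  · simpa using hn'
  exfalso
  have h2 : (2 : ℝ) ≤ n := by
    have : (2 : ℤ) ≤ n := by omega
    exact_mod_cast this
  obtain ⟨u, hu, hu'⟩ := intermediate_value_Icc (show s ≤ s + L by linarith [hγ.length_pos])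
    hγ.continuous_tangentAngle.continuousOn
    (show tangentAngle γ s + 2 * Real.pi ∈ Set.Icc _ _ from ⟨by linarith, by nlinarith⟩)
  have h3 : s < u := hγ.strictMono_tangentAngle.lt_iff_lt.1 (by linarith)
  have h4 : u < s + L := hγ.strictMono_tangentAngle.lt_iff_lt.1 (by nlinarith)
  refine hγ.tangent_ne h3 h4 ?_
  rw [hγ.tangent_eq, hγ.tangent_eq, hu']
  push_cast
  rw [add_mul, Complex.exp_add, Complex.exp_two_pi_mul_I, mul_one]

theorem IsOval.larmorCenter_add (hγ : IsOval γ L) (R s : ℝ) :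
    larmorCenter γ R (s + L) = larmorCenter γ R s := by
  rw [larmorCenter, larmorCenter, hγ.tangent_add, hγ.periodic]

theorem IsOval.hasDerivAt_larmorCenter (hγ : IsOval γ L) (R s : ℝ) :
    HasDerivAt (larmorCenter γ R) ((1 - R * curvature γ s : ℝ) * deriv γ s) s := by
  refine ((hγ.hasDerivAt s).add
    (((hγ.hasDerivAt_tangent s).const_mul Complex.I).const_mul (R : ℂ))).congr_deriv ?_
  push_cast
  linear_combination (R : ℂ) * curvature γ s * deriv γ s * Complex.I_mul_I

theorem IsOval.continuous_larmorCenter (hγ : IsOval γ L) (R : ℝ) :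
    Continuous (larmorCenter γ R) :=
  continuous_iff_continuousAt.2 fun s => (hγ.hasDerivAt_larmorCenter R s).continuousAt

theorem IsOval.radius_pos (hγ : IsOval γ L) (hR : ∀ s, (curvature γ s)⁻¹ < R) : 0 < R :=
  (inv_pos.2 (hγ.curvature_pos 0)).trans (hR 0)

theorem IsOval.one_lt_mul (hγ : IsOval γ L) (hR : ∀ s, (curvature γ s)⁻¹ < R) (s : ℝ) :
    1 < R * curvature γ s := by
  have := hR s
  rwa [inv_lt_iff_one_lt_mul₀ (hγ.curvature_pos s)] at this

/-- The curve of centers is strictly convex. -/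
theorem IsOval.cross_larmorCenter_neg (hγ : IsOval γ L) (hR : ∀ s, (curvature γ s)⁻¹ < R)
    {s t : ℝ} (h1 : s < t) (h2 : t < s + L) :
    cross (deriv γ s) (larmorCenter γ R t - larmorCenter γ R s) < 0 := by
  set f : ℝ → ℝ := fun x => cross (deriv γ s) (larmorCenter γ R x - larmorCenter γ R s) with hf
  have hd : ∀ x, HasDerivAt f
      ((1 - R * curvature γ x) * Real.sin (tangentAngle γ x - tangentAngle γ s)) x := fun x => by
    refine ((hasDerivAt_const x (deriv γ s)).cross
      ((hγ.hasDerivAt_larmorCenter R x).sub_const _)).congr_deriv ?_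
    rw [← cross_exp, ← hγ.tangent_eq, ← hγ.tangent_eq]
    simp [cross]; ring
  have hc : Continuous f := continuous_iff_continuousAt.2 fun x => (hd x).continuousAt
  have hs : f s = 0 := by simp [hf, cross]
  have hsL : f (s + L) = 0 := by simp [hf, cross, hγ.larmorCenter_add]
  have hmono := hγ.strictMono_tangentAngle
  have hper := hγ.tangentAngle_add s
  -- `f` vanishes at `s` and at `s + L`, falls until the tangent has turned by `π`, and rises
  -- afterwards; `t` is compared with the zero on its own side.
  rcases le_or_gt (tangentAngle γ t) (tangentAngle γ s + Real.pi) with h | h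
  · have : StrictAntiOn f (Set.Icc s t) := strictAntiOn_of_deriv_neg (convex_Icc s t)
      hc.continuousOn fun x hx => by
        rw [interior_Icc] at hx
        rw [(hd x).deriv]
        refine mul_neg_of_neg_of_pos (by linarith [hγ.one_lt_mul hR x])
          (Real.sin_pos_of_pos_of_lt_pi ?_ ?_)
        · linarith [hmono hx.1]
        · linarith [hmono hx.2]
    rw [← hs]
    exact this ⟨le_rfl, h1.le⟩ ⟨h1.le, le_rfl⟩ h1
  · have : StrictMonoOn f (Set.Icc t (s + L)) := strictMonoOn_of_deriv_pos (convex_Icc t (s + L))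
      hc.continuousOn fun x hx => by
        rw [interior_Icc] at hx
        rw [(hd x).deriv]
        refine mul_pos_of_neg_of_neg (by linarith [hγ.one_lt_mul hR x]) ?_
        rw [← Real.sin_sub_two_pi]
        refine Real.sin_neg_of_neg_of_neg_pi_lt ?_ ?_
        · linarith [hmono hx.2]
        · linarith [hmono hx.1]
    rw [← hsL]
    exact this ⟨le_rfl, h2.le⟩ ⟨h2.le, le_rfl⟩ h2

/-- Every circle `C_t` encloses the oval (Blaschke's rolling theorem). -/
theorem IsOval.normSq_sub_larmorCenter_lt (hγ : IsOval γ L) (hR : ∀ s, (curvature γ s)⁻¹ < R)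
    {s t : ℝ} (h1 : t < s) (h2 : s < t + L) :
    dot (γ s - larmorCenter γ R t) (γ s - larmorCenter γ R t) < R ^ 2 := by
  have hRp := hγ.radius_pos hR
  set f : ℝ → ℝ := fun x => dot (γ x - larmorCenter γ R t) (γ x - larmorCenter γ R t) with hf
  have hd : ∀ x, HasDerivAt f (2 * dot (γ x - larmorCenter γ R t) (deriv γ x)) x := fun x => by
    have := (hγ.hasDerivAt x).sub_const (larmorCenter γ R t)
    refine (this.dot this).congr_deriv ?_
    simp only [dot]; ring
  have hc : Continuous f := continuous_iff_continuousAt.2 fun x => (hd x).continuousAt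
  have hft : f t = R ^ 2 := by
    have := hγ.dot_tangent_self t
    simp only [dot] at this
    simp [hf, larmorCenter, dot]
    linear_combination R ^ 2 * this
  have hftL : f (t + L) = R ^ 2 := by
    rw [← hft]; simp only [hf, hγ.periodic t]
  -- Otherwise some interior `m` maximizes the distance to the center, with value at least `R`, and
  -- there the vector from the center is normal to `γ`. Its signed length exceeds `-R` by convexity
  -- of the curve of centers, so it is at least `R`. Strict convexity of `γ` at `m` then puts `γ t`
  -- at distance more than `R` from its own center.
  by_contra! hs
  change R ^ 2 ≤ f s at hs
  obtain ⟨m, hm1, hm2, hm⟩ : ∃ m, t < m ∧ m < t + L ∧ ∀ x ∈ Set.Icc t (t + L), f x ≤ f m := by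
    obtain ⟨m, hm, hmax⟩ := isCompact_Icc.exists_isMaxOn
      (⟨s, h1.le, h2.le⟩ : (Set.Icc t (t + L)).Nonempty) hc.continuousOn
    by_cases h : m = t ∨ m = t + L
    · have hfm : f m = R ^ 2 := by rcases h with rfl | rfl <;> assumption
      refine ⟨s, h1, h2, fun x hx => ?_⟩
      have := hmax hx
      simp only [Set.mem_ofPred_eq] at this
      linarith
    · push Not at h
      exact ⟨m, lt_of_le_of_ne hm.1 h.1.symm, lt_of_le_of_ne hm.2 h.2, fun x hx => hmax hx⟩
  have h0 : 2 * dot (γ m - larmorCenter γ R t) (deriv γ m) = 0 := by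
    refine IsLocalMax.hasDerivAt_eq_zero ?_ (hd m)
    filter_upwards [Icc_mem_nhds hm1 hm2] with x hx using hm x hx
  have hge : R ^ 2 ≤ f m := hs.trans (hm s ⟨h1.le, h2.le⟩)
  have hT := hγ.dot_tangent_self m
  have hTt := hγ.dot_tangent_self t
  have hY : f m = cross (deriv γ m) (γ m - larmorCenter γ R t) ^ 2 := by
    simp only [hf, dot, cross] at *
    linear_combination (-((γ m - larmorCenter γ R t).re ^ 2 +
      (γ m - larmorCenter γ R t).im ^ 2)) * hT + (1 / 2 : ℝ) *
      ((γ m - larmorCenter γ R t).re * (deriv γ m).re +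
        (γ m - larmorCenter γ R t).im * (deriv γ m).im) * h0
  have hK := hγ.cross_larmorCenter_neg hR (s := m) (t := t + L) hm2 (by linarith)
  rw [hγ.larmorCenter_add] at hK
  have hY1 : -R < cross (deriv γ m) (γ m - larmorCenter γ R t) := by
    have : cross (deriv γ m) (γ m - larmorCenter γ R t) =
        -R - cross (deriv γ m) (larmorCenter γ R t - larmorCenter γ R m) := by
      simp only [larmorCenter, cross, dot] at *
      simp
      linear_combination (-R) * hT
    linarith
  have hY2 : R ≤ cross (deriv γ m) (γ m - larmorCenter γ R t) := by
    by_contra! h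
    nlinarith
  have hconv := hγ.strictly_convex m t (hγ.ne_of_lt hm1 hm2).symm
  have hY3 : R < cross (deriv γ m) (γ t - larmorCenter γ R t) := by
    simp only [cross, Complex.sub_re, Complex.sub_im] at *
    linarith
  have hY4 : cross (deriv γ m) (γ t - larmorCenter γ R t) = -R * dot (deriv γ m) (deriv γ t) := by
    simp [larmorCenter, cross, dot]; ring
  have hd2 : -1 ≤ dot (deriv γ m) (deriv γ t) := by
    simp only [dot] at *
    nlinarith [sq_nonneg ((deriv γ m).re + (deriv γ t).re),
      sq_nonneg ((deriv γ m).im + (deriv γ t).im)]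
  rw [hY4] at hY3
  nlinarith

end Oval

/-! ### Strip areas and chord inequalities -/

/-- Half of the area of the part of a disc of radius `R` that lies in a strip of width `r` centered
at its center. -/
def stripArea (R r : ℝ) : ℝ := R ^ 2 * Real.arcsin (r / (2 * R)) + r / 2 * √(R ^ 2 - r ^ 2 / 4)

section Strip

variable {R : ℝ}

theorem continuous_stripArea (R : ℝ) : Continuous (stripArea R) := by
  unfold stripArea
  exact (continuous_const.mul (Real.continuous_arcsin.comp (by fun_prop))).add (by fun_prop)

theorem hasDerivAt_stripArea {r : ℝ} (hR : 0 < R) (hr : r ^ 2 < 4 * R ^ 2) :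
    HasDerivAt (stripArea R) √(R ^ 2 - r ^ 2 / 4) r := by
  have hpos : 0 < R ^ 2 - r ^ 2 / 4 := by linarith
  set W := √(R ^ 2 - r ^ 2 / 4) with hW
  have hWp : 0 < W := Real.sqrt_pos.2 hpos
  have hW2 : W ^ 2 = R ^ 2 - r ^ 2 / 4 := Real.sq_sqrt hpos.le
  have habs : |r| < 2 * R := abs_lt_of_sq_lt_sq (by linarith) (by linarith)
  rw [abs_lt] at habs
  have h1 : r / (2 * R) ≠ -1 := by
    rw [ne_eq, div_eq_iff (by positivity)]; linarith
  have h2 : r / (2 * R) ≠ 1 := by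
    rw [ne_eq, div_eq_iff (by positivity)]; linarith
  have h3 : √(1 - (r / (2 * R)) ^ 2) = W / R := by
    rw [show 1 - (r / (2 * R)) ^ 2 = (W / R) ^ 2 by
      rw [div_pow W, hW2]; field_simp; ring]
    exact Real.sqrt_sq (by positivity)
  have hd1 : HasDerivAt (fun r : ℝ => Real.arcsin (r / (2 * R))) (1 / (W / R) * (1 / (2 * R))) r := by
    rw [← h3]
    exact HasDerivAt.comp r (Real.hasDerivAt_arcsin h1 h2) ((hasDerivAt_id r).div_const _)
  have hd2 : HasDerivAt (fun r : ℝ => R ^ 2 - r ^ 2 / 4) (-(r / 2)) r := by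
    refine (((hasDerivAt_id r).pow 2).div_const 4).const_sub (R ^ 2) |>.congr_deriv ?_
    simp; ring
  refine ((hd1.const_mul (R ^ 2)).add
    (((hasDerivAt_id r).div_const 2).mul (hd2.sqrt hpos.ne'))).congr_deriv ?_
  rw [← hW]
  simp only [id]
  field_simp
  rw [hW2]
  ring

/-- The square root is half the common chord of two circles of radius `R` with centers `D x` apart,
divided by `‖D x‖`. -/
theorem hasDerivAt_stripArea_norm {D : ℝ → ℂ} {D' : ℂ} {x : ℝ} (hR : 0 < R) (hD : HasDerivAt D D' x)
    (h0 : 0 < dot (D x) (D x)) (h1 : dot (D x) (D x) < 4 * R ^ 2) :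
    HasDerivAt (fun x => stripArea R ‖D x‖)
      (√(R ^ 2 / dot (D x) (D x) - 1 / 4) * dot (D x) D') x := by
  have hn : HasDerivAt (fun x => ‖D x‖) (dot (D x) D' / √(dot (D x) (D x))) x := by
    simp only [norm_eq_sqrt_dot]
    refine ((hD.dot hD).sqrt h0.ne').congr_deriv ?_
    rw [show dot D' (D x) = dot (D x) D' by simp only [dot]; ring]
    field_simp
    ring
  refine (HasDerivAt.comp x (hasDerivAt_stripArea hR (r := ‖D x‖)
    (by rwa [← dot_self_eq])) hn).congr_deriv ?_
  rw [← dot_self_eq, show R ^ 2 / dot (D x) (D x) - 1 / 4 =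
    (R ^ 2 - dot (D x) (D x) / 4) / dot (D x) (D x) by field_simp, Real.sqrt_div' _ h0.le]
  ring

/-- `c` and `p` stand for the normal and tangential components of the chord between two centers. The
bound on `c ^ 2 + p ^ 2` then says that the tangency point of one circle lies strictly inside the
other. Clearing denominators turns the last claim into its square. -/
theorem two_mul_sqrt_mul_gt {c p : ℝ} (h0 : 0 < c ^ 2 + p ^ 2)
    (hc : c ^ 2 + p ^ 2 < 2 * R * c) :
    0 < R ^ 2 / (c ^ 2 + p ^ 2) - 1 / 4 ∧ 0 < c * R ∧
      p ^ 2 < (2 * √(R ^ 2 / (c ^ 2 + p ^ 2) - 1 / 4) * c) ^ 2 := by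
  have hRc : 0 < c * R := by linarith
  have hsq : (c ^ 2 + p ^ 2) ^ 2 < (2 * R * c) ^ 2 := by
    apply pow_lt_pow_left₀ hc h0.le; norm_num
  have h3 : c ^ 2 + p ^ 2 < 4 * R ^ 2 := by
    by_contra! h
    nlinarith [mul_nonneg (sq_nonneg c) (sub_nonneg.2 h), sq_nonneg p]
  have hpos : 0 < R ^ 2 / (c ^ 2 + p ^ 2) - 1 / 4 := by
    rw [sub_pos, lt_div_iff₀ h0]; linarith
  refine ⟨hpos, hRc, ?_⟩
  rw [mul_pow, mul_pow, Real.sq_sqrt hpos.le, show (2 : ℝ) ^ 2 * (R ^ 2 / (c ^ 2 + p ^ 2) - 1 / 4) *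
    c ^ 2 = (4 * R ^ 2 * c ^ 2 - c ^ 2 * (c ^ 2 + p ^ 2)) / (c ^ 2 + p ^ 2) by field_simp; ring,
    lt_div_iff₀ h0]
  nlinarith

/-- The squares of the left side and of `p / 2 - κ * c'`, where `κ` is the root, sum to `R ^ 2`; the
second is nonzero by `two_mul_sqrt_mul_gt`. -/
theorem half_add_sqrt_mul_lt {c c' p : ℝ} (hR : 0 < R) (h0 : 0 < c ^ 2 + p ^ 2)
    (hc : c ^ 2 + p ^ 2 < 2 * R * c) (hc' : c' = c ∨ c' = -c) :
    1 / 2 * c' + √(R ^ 2 / (c ^ 2 + p ^ 2) - 1 / 4) * p < R := by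
  obtain ⟨h1, -, h2⟩ := two_mul_sqrt_mul_gt h0 hc
  set κ := √(R ^ 2 / (c ^ 2 + p ^ 2) - 1 / 4) with hκ
  have hκ2 : κ ^ 2 = R ^ 2 / (c ^ 2 + p ^ 2) - 1 / 4 := Real.sq_sqrt h1.le
  have hκ3 : (κ ^ 2 + 1 / 4) * (c ^ 2 + p ^ 2) = R ^ 2 := by
    rw [hκ2]; field_simp; ring
  have hc2 : c' ^ 2 = c ^ 2 := by rcases hc' with rfl | rfl <;> ring
  have h3 : (1 / 2 * p - κ * c') ≠ 0 := by
    intro h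
    have : p = 2 * κ * c' := by linarith
    rw [this, mul_pow, mul_pow _ c, hc2] at h2
    exact lt_irrefl _ h2
  have h4 : (1 / 2 * c' + κ * p) ^ 2 + (1 / 2 * p - κ * c') ^ 2 = R ^ 2 := by
    rw [← hκ3, ← hc2]; ring
  have h5 := pow_pos (abs_pos.2 h3) 2
  rw [sq_abs] at h5
  exact lt_of_pow_lt_pow_left₀ 2 hR.le (by linarith)

end Strip

/-! ### The vertex area and its twist condition -/

/-- The contribution of the vertex between the sides tangent at `γ s` and `γ t` to the area of a
circumscribed polygon. -/
def vertexArea (γ : ℝ → ℂ) (R s t : ℝ) : ℝ :=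
  R ^ 2 / 2 * (tangentAngle γ t - tangentAngle γ s) +
    1 / 2 * cross (larmorCenter γ R s) (larmorCenter γ R t) -
    stripArea R ‖larmorCenter γ R t - larmorCenter γ R s‖

/-- The number `-R * cos a`, where `a` is the angle on `C_s` from the tangency point `γ s` to the
vertex between the sides tangent at `γ s` and `γ t`. -/
def vertexCos (γ : ℝ → ℂ) (R s t : ℝ) : ℝ :=
  1 / 2 * cross (deriv γ s) (larmorCenter γ R t - larmorCenter γ R s) +
    √(R ^ 2 / dot (larmorCenter γ R t - larmorCenter γ R s)
      (larmorCenter γ R t - larmorCenter γ R s) - 1 / 4) *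
      dot (larmorCenter γ R t - larmorCenter γ R s) (deriv γ s)

section Oval

variable {γ : ℝ → ℂ} {L R : ℝ}

theorem cross_sq_add_dot_sq {T D : ℂ} (hT : dot T T = 1) :
    cross T D ^ 2 + dot D T ^ 2 = dot D D := by
  simp only [cross, dot] at *
  linear_combination (D.re ^ 2 + D.im ^ 2) * hT

theorem IsOval.chord_pos (hγ : IsOval γ L) (hR : ∀ s, (curvature γ s)⁻¹ < R)
    {s t : ℝ} (h1 : s < t) (h2 : t < s + L) :
    0 < dot (larmorCenter γ R t - larmorCenter γ R s) (larmorCenter γ R t - larmorCenter γ R s) := by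
  have h := hγ.cross_larmorCenter_neg hR h1 h2
  rw [← cross_sq_add_dot_sq (hγ.dot_tangent_self s)]
  nlinarith [sq_nonneg (dot (larmorCenter γ R t - larmorCenter γ R s) (deriv γ s))]

theorem IsOval.chord_lt_left (hγ : IsOval γ L) (hR : ∀ s, (curvature γ s)⁻¹ < R)
    {s t : ℝ} (h1 : s < t) (h2 : t < s + L) :
    dot (larmorCenter γ R t - larmorCenter γ R s) (larmorCenter γ R t - larmorCenter γ R s) <
      2 * R * -cross (deriv γ s) (larmorCenter γ R t - larmorCenter γ R s) := by
  have h := hγ.normSq_sub_larmorCenter_lt hR (s := s + L) h2 (by linarith)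
  rw [hγ.periodic] at h
  have hT := hγ.dot_tangent_self s
  have hs : γ s = larmorCenter γ R s - R * (Complex.I * deriv γ s) := by simp [larmorCenter]
  rw [hs] at h
  generalize larmorCenter γ R t = z at *
  generalize larmorCenter γ R s = w at *
  simp only [dot, cross] at *
  simp at h
  simp
  linear_combination h - R ^ 2 * hT

theorem IsOval.chord_lt_right (hγ : IsOval γ L) (hR : ∀ s, (curvature γ s)⁻¹ < R)
    {s t : ℝ} (h1 : s < t) (h2 : t < s + L) :
    dot (larmorCenter γ R t - larmorCenter γ R s) (larmorCenter γ R t - larmorCenter γ R s) <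
      2 * R * cross (deriv γ t) (larmorCenter γ R t - larmorCenter γ R s) := by
  have h := hγ.normSq_sub_larmorCenter_lt hR h1 h2
  have hT := hγ.dot_tangent_self t
  have hs : γ t = larmorCenter γ R t - R * (Complex.I * deriv γ t) := by simp [larmorCenter]
  rw [hs] at h
  generalize larmorCenter γ R t = z at *
  generalize larmorCenter γ R s = w at *
  simp only [dot, cross] at *
  simp at h
  simp
  linear_combination h - R ^ 2 * hT

theorem IsOval.chord_lt (hγ : IsOval γ L) (hR : ∀ s, (curvature γ s)⁻¹ < R)
    {s t : ℝ} (h1 : s < t) (h2 : t < s + L) :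
    dot (larmorCenter γ R t - larmorCenter γ R s) (larmorCenter γ R t - larmorCenter γ R s) <
      4 * R ^ 2 := by
  have h3 := hγ.chord_lt_right hR h1 h2
  have h4 := hγ.chord_pos hR h1 h2
  rw [← cross_sq_add_dot_sq (hγ.dot_tangent_self t)] at h3 h4 ⊢
  have h5 := (two_mul_sqrt_mul_gt h4 h3).1
  rw [sub_pos, lt_div_iff₀ h4] at h5
  linarith

theorem IsOval.vertexCos_lt (hγ : IsOval γ L) (hR : ∀ s, (curvature γ s)⁻¹ < R)
    {s t : ℝ} (h1 : s < t) (h2 : t < s + L) : vertexCos γ R s t < R := by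
  have h3 := hγ.chord_lt_left hR h1 h2
  have h4 := hγ.chord_pos hR h1 h2
  have h5 := cross_sq_add_dot_sq (D := larmorCenter γ R t - larmorCenter γ R s)
    (hγ.dot_tangent_self s)
  unfold vertexCos
  rw [← h5] at h3 h4 ⊢
  rw [← neg_sq (cross _ _)] at h3 h4 ⊢
  exact half_add_sqrt_mul_lt (hγ.radius_pos hR) h4 h3 (Or.inr (by ring))

/-- Expanding `T` and `T'` in the orthogonal frame of `D` factors the derivative of `vertexCos` in
its second argument; `-μ * T'` is the velocity of the moving center. -/
theorem mixed_derivative_eq {κ μ : ℝ} {D T T' : ℂ} (hD : dot D D ≠ 0) (hκ : κ ≠ 0)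
    (hR : R ^ 2 = (κ ^ 2 + 1 / 4) * dot D D) :
    -μ / 2 * cross T T' + (2 * μ * R ^ 2 * dot D T' / dot D D ^ 2 / (2 * κ) * dot D T +
      κ * (-μ * dot T T')) =
    μ / (4 * κ * dot D D) * (2 * κ * -cross T D + dot D T) *
      (2 * κ * cross T' D + dot D T') := by
  have h1 : cross T T' = (-dot D T * cross T' D + cross T D * dot D T') / dot D D := by
    rw [eq_div_iff hD]; simp only [cross, dot]; ring
  have h2 : dot T T' = (dot D T * dot D T' + cross T D * cross T' D) / dot D D := by
    rw [eq_div_iff hD]; simp only [cross, dot]; ring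
  rw [hR, h1, h2]
  field_simp
  ring

/-- This is the twist condition: `vertexCos` enters the first derivative of `vertexArea` with the
negative coefficient `-(R * k - 1)`. -/
theorem IsOval.strictMonoOn_vertexCos (hγ : IsOval γ L) (hR : ∀ s, (curvature γ s)⁻¹ < R) (s : ℝ) :
    StrictMonoOn (vertexCos γ R s) (Set.Ioo s (s + L)) := by
  have hd : ∀ x ∈ Set.Ioo s (s + L), ∃ d, 0 < d ∧ HasDerivAt (vertexCos γ R s) d x := by
    intro x hx
    have h1 := hγ.chord_lt_left hR hx.1 hx.2
    have h2 := hγ.chord_lt_right hR hx.1 hx.2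
    have h3 := hγ.chord_pos hR hx.1 hx.2
    have hD : HasDerivAt (fun x => larmorCenter γ R x - larmorCenter γ R s)
      ((1 - R * curvature γ x : ℝ) * deriv γ x) x := (hγ.hasDerivAt_larmorCenter R x).sub_const _
    have hμ := hγ.one_lt_mul hR x
    have hTs := hγ.dot_tangent_self s
    have hTx := hγ.dot_tangent_self x
    have hP := cross_sq_add_dot_sq (D := larmorCenter γ R x - larmorCenter γ R s) hTs
    have hP' := cross_sq_add_dot_sq (D := larmorCenter γ R x - larmorCenter γ R s) hTx
    have h4 : 0 < R ^ 2 / dot (larmorCenter γ R x - larmorCenter γ R s)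
      (larmorCenter γ R x - larmorCenter γ R s) - 1 / 4 := by
      have := hγ.chord_lt hR hx.1 hx.2
      rw [sub_pos, lt_div_iff₀ h3]; linarith
    have hκd := (((hasDerivAt_const x (R ^ 2)).fun_div (hD.dot hD) h3.ne').sub_const (1 / 4)).sqrt h4.ne'
    refine ⟨_, ?_, (((hasDerivAt_const x (deriv γ s)).cross hD).const_mul (1 / 2)).add
      (hκd.mul (hD.dot (hasDerivAt_const x (deriv γ s))))⟩
    generalize larmorCenter γ R x - larmorCenter γ R s = D at *
    set κ := √(R ^ 2 / dot D D - 1 / 4) with hκ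
    have hκp : 0 < κ := Real.sqrt_pos.2 h4
    have hκ2 : R ^ 2 = (κ ^ 2 + 1 / 4) * dot D D := by
      rw [hκ, Real.sq_sqrt h4.le]; field_simp; ring
    rw [← neg_sq (cross _ _)] at hP
    rw [← hP] at h1 h3
    have h5 := (two_mul_sqrt_mul_gt h3 h1)
    rw [hP] at h5 h1 h3
    rw [← hP'] at h2
    have h6 := (two_mul_sqrt_mul_gt (by rw [hP']; exact h3) h2)
    rw [hP'] at h6
    have hRp := hγ.radius_pos hR
    have h7 := abs_lt_of_sq_lt_sq h5.2.2
      (mul_nonneg (mul_nonneg zero_le_two hκp.le) (pos_of_mul_pos_left h5.2.1 hRp.le).le)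
    have h8 := abs_lt_of_sq_lt_sq h6.2.2
      (mul_nonneg (mul_nonneg zero_le_two hκp.le) (pos_of_mul_pos_left h6.2.1 hRp.le).le)
    rw [← hκ, abs_lt] at h7 h8
    have h9 := mixed_derivative_eq (μ := R * curvature γ x - 1) (T := deriv γ s)
      (T' := deriv γ x) h3.ne' hκp.ne' hκ2
    refine lt_of_lt_of_eq ?_ (h9.symm.trans ?_)
    · refine mul_pos (mul_pos (div_pos (by linarith) (by positivity)) ?_) ?_ <;> linarith [h7.1, h8.2]
    · congr 1
      · simp [cross]; ring
      · congr 1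
        · congr 3
          simp [dot]; ring
        · simp [dot]; left; ring
  refine strictMonoOn_of_deriv_pos (convex_Ioo _ _) (fun x hx => ?_) fun x hx => ?_
  · obtain ⟨d, -, h⟩ := hd x hx
    exact h.continuousAt.continuousWithinAt
  · rw [interior_Ioo] at hx
    obtain ⟨d, h0, h⟩ := hd x hx
    rwa [h.deriv]

end Oval

/-! ### First variation -/

section FirstVariation

theorem HasDerivWithinAt.eventually_lt {f : ℝ → ℝ} {f' v : ℝ}
    (hf : HasDerivWithinAt f f' (Set.Ioi v) v) (h : f' < 0) :
    ∀ᶠ u in nhdsWithin v (Set.Ioi v), f u < f v := by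
  have h1 := (hasDerivWithinAt_iff_tendsto_slope' (by simp)).1 hf
  filter_upwards [h1.eventually_lt_const h, self_mem_nhdsWithin] with u hu huv
  rw [slope_def_field, div_lt_iff₀ (sub_pos.2 huv), zero_mul] at hu
  linarith

theorem HasDerivAt.eventually_lt_left {f : ℝ → ℝ} {f' v : ℝ}
    (hf : HasDerivAt f f' v) (h : 0 < f') :
    ∀ᶠ u in nhdsWithin v (Set.Iio v), f u < f v := by
  have h1 := (hasDerivWithinAt_iff_tendsto_slope' (by simp)).1
    (hf.hasDerivWithinAt (s := Set.Iio v))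
  filter_upwards [h1.eventually_const_lt h, self_mem_nhdsWithin] with u hu huv
  rw [slope_def_field, ← neg_div_neg_eq, lt_div_iff₀ (by linarith [Set.mem_Iio.1 huv]),
    zero_mul] at hu
  linarith

/-- Needed at full steps: the two centers coincide there and their distance has a corner. -/
theorem HasDerivAt.norm_right {f : ℝ → ℂ} {f' : ℂ} {v : ℝ} (hf : HasDerivAt f f' v)
    (h0 : f v = 0) : HasDerivWithinAt (fun u => ‖f u‖) ‖f'‖ (Set.Ioi v) v := by
  rw [hasDerivWithinAt_iff_tendsto_slope' (by simp)]
  have h1 := ((hasDerivWithinAt_iff_tendsto_slope' (by simp)).1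
    (hf.hasDerivWithinAt (s := Set.Ioi v))).norm
  refine h1.congr' ?_
  filter_upwards [self_mem_nhdsWithin] with u hu
  have hu' : 0 < u - v := sub_pos.2 hu
  rw [slope_def_module, slope_def_field, h0, norm_zero, sub_zero, sub_zero, norm_smul, norm_inv,
    Real.norm_of_nonneg hu'.le]
  field_simp

end FirstVariation

section Oval

variable {γ : ℝ → ℂ} {L R : ℝ}

/-- The part of the first derivatives of `vertexArea` that depends on one tangency point only. -/
def centerForm (γ : ℝ → ℂ) (R v : ℝ) : ℝ :=
  1 / 2 * cross ((1 - R * curvature γ v : ℝ) * deriv γ v) (larmorCenter γ R v) -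
    R ^ 2 / 2 * curvature γ v

theorem IsOval.hasDerivAt_vertexArea_left (hγ : IsOval γ L) (hR : ∀ s, (curvature γ s)⁻¹ < R)
    {v x : ℝ} (h1 : v < x) (h2 : x < v + L) :
    HasDerivAt (fun u => vertexArea γ R u x)
      (centerForm γ R v - (R * curvature γ v - 1) * vertexCos γ R v x) v := by
  have hΓ := hγ.hasDerivAt_larmorCenter R v
  refine (((((hγ.hasDerivAt_tangentAngle v).const_sub (tangentAngle γ x)).const_mul (R ^ 2 / 2)).add
    ((hΓ.cross (hasDerivAt_const v (larmorCenter γ R x))).const_mul (1 / 2))).sub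
    (hasDerivAt_stripArea_norm (hγ.radius_pos hR) (hΓ.const_sub (larmorCenter γ R x))
      (hγ.chord_pos hR h1 h2) (hγ.chord_lt hR h1 h2))).congr_deriv ?_
  unfold vertexCos centerForm
  generalize √(R ^ 2 / dot (larmorCenter γ R x - larmorCenter γ R v)
    (larmorCenter γ R x - larmorCenter γ R v) - 1 / 4) = κ
  simp [cross, dot]
  ring

theorem IsOval.hasDerivAt_vertexArea_right (hγ : IsOval γ L) (hR : ∀ s, (curvature γ s)⁻¹ < R)
    {s v : ℝ} (h1 : s < v) (h2 : v < s + L) :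
    ∃ c < R, HasDerivAt (fun u => vertexArea γ R s u)
      (-centerForm γ R v + (R * curvature γ v - 1) * c) v := by
  have hΓ := hγ.hasDerivAt_larmorCenter R v
  have h3 := hγ.chord_lt_right hR h1 h2
  have h4 := hγ.chord_pos hR h1 h2
  have h5 := cross_sq_add_dot_sq (D := larmorCenter γ R v - larmorCenter γ R s)
    (hγ.dot_tangent_self v)
  refine ⟨_, half_add_sqrt_mul_lt (hγ.radius_pos hR) (h5.symm ▸ h4) (h5.symm ▸ h3)
    (Or.inr rfl), ?_⟩
  refine (((((hγ.hasDerivAt_tangentAngle v).sub_const (tangentAngle γ s)).const_mul (R ^ 2 / 2)).add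
    (((hasDerivAt_const v (larmorCenter γ R s)).cross hΓ).const_mul (1 / 2))).sub
    (hasDerivAt_stripArea_norm (hγ.radius_pos hR) (hΓ.sub_const (larmorCenter γ R s))
      (hγ.chord_pos hR h1 h2) (hγ.chord_lt hR h1 h2))).congr_deriv ?_
  rw [h5]
  unfold centerForm
  generalize √(R ^ 2 / dot (larmorCenter γ R v - larmorCenter γ R s)
    (larmorCenter γ R v - larmorCenter γ R s) - 1 / 4) = κ
  simp [cross, dot]
  ring

/-- The role of `vertexCos` is played by `R`, its value for a vertex at angle `π`, which by
`vertexCos_lt` exceeds all others. -/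
theorem IsOval.hasDerivWithinAt_vertexArea_add (hγ : IsOval γ L)
    (hR : ∀ s, (curvature γ s)⁻¹ < R) (v : ℝ) :
    HasDerivWithinAt (fun u => vertexArea γ R u (v + L))
      (centerForm γ R v - (R * curvature γ v - 1) * R) (Set.Ioi v) v := by
  have hRp := hγ.radius_pos hR
  have hΓ := hγ.hasDerivAt_larmorCenter R v
  have hn := (hΓ.const_sub (larmorCenter γ R (v + L))).norm_right (by
    rw [hγ.larmorCenter_add, sub_self])
  have hl := hasDerivAt_stripArea (R := R) (r := ‖larmorCenter γ R (v + L) - larmorCenter γ R v‖)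
    hRp (by rw [hγ.larmorCenter_add, sub_self, norm_zero]; nlinarith [pow_pos hRp 2])
  have hln := HasDerivAt.comp_hasDerivWithinAt v hl hn
  refine (((((hγ.hasDerivAt_tangentAngle v).const_sub (tangentAngle γ (v + L))).const_mul
    (R ^ 2 / 2)).add ((hΓ.cross (hasDerivAt_const v (larmorCenter γ R (v + L)))).const_mul
      (1 / 2))).hasDerivWithinAt.sub hln).congr_deriv ?_
  rw [hγ.larmorCenter_add, sub_self, norm_zero, norm_neg, norm_mul, hγ.unit_speed, mul_one,
    Complex.norm_real, Real.norm_of_nonpos (by linarith [hγ.one_lt_mul hR v])]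
  norm_num
  rw [Real.sqrt_sq hRp.le]
  simp [cross, centerForm]
  ring

theorem IsOval.continuous_vertexArea (hγ : IsOval γ L) (R : ℝ) :
    Continuous fun x : ℝ × ℝ => vertexArea γ R x.1 x.2 := by
  have h1 : Continuous fun x : ℝ × ℝ => larmorCenter γ R x.1 :=
    (hγ.continuous_larmorCenter R).comp continuous_fst
  have h2 : Continuous fun x : ℝ × ℝ => larmorCenter γ R x.2 :=
    (hγ.continuous_larmorCenter R).comp continuous_snd
  have h3 : Continuous fun x : ℝ × ℝ => tangentAngle γ x.1 :=
    hγ.continuous_tangentAngle.comp continuous_fst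
  have h4 : Continuous fun x : ℝ × ℝ => tangentAngle γ x.2 :=
    hγ.continuous_tangentAngle.comp continuous_snd
  have h5 := (continuous_stripArea R).comp (h2.sub h1).norm
  unfold vertexArea cross
  exact ((continuous_const.mul (h4.sub h3)).add (continuous_const.mul
    (((Complex.continuous_re.comp h1).mul (Complex.continuous_im.comp h2)).sub
    ((Complex.continuous_im.comp h1).mul (Complex.continuous_re.comp h2))))).sub h5

theorem IsOval.isTwistCost_vertexArea (hγ : IsOval γ L) (hR : ∀ s, (curvature γ s)⁻¹ < R) :
    IsTwistCost (vertexArea γ R) L where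
  length_pos := hγ.length_pos
  cont := hγ.continuous_vertexArea R
  shift x y := by
    simp only [vertexArea, hγ.larmorCenter_add, hγ.tangentAngle_add]; ring
  diag x := by simp [vertexArea, cross, stripArea]; ring
  submodular s t s' t' h1 h2 h3 h4 := by
    have hc : ∀ x, Continuous fun u => vertexArea γ R u x := fun x =>
      (hγ.continuous_vertexArea R).comp (continuous_id.prodMk continuous_const)
    -- The derivative is `(R * k - 1) * (vertexCos γ R u t' - vertexCos γ R u s')`.
    have hmono : StrictMonoOn (fun u => vertexArea γ R u s' - vertexArea γ R u t')
        (Set.Icc s t) := by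
      refine strictMonoOn_of_deriv_pos (convex_Icc s t) ((hc s').sub (hc t')).continuousOn
        fun u hu => ?_
      rw [interior_Icc] at hu
      have hu1 := hu.1
      have hu2 := hu.2
      rw [((hγ.hasDerivAt_vertexArea_left hR (v := u) (x := s') (by linarith) (by linarith)).fun_sub
        (hγ.hasDerivAt_vertexArea_left hR (x := t') (by linarith) (by linarith))).deriv]
      have := hγ.strictMonoOn_vertexCos hR u (a := s') (b := t') ⟨by linarith, by linarith⟩
        ⟨by linarith, by linarith⟩ h3
      nlinarith [hγ.one_lt_mul hR u]
    have := hmono ⟨le_rfl, h1.le⟩ ⟨h1.le, le_rfl⟩ h1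
    simp only at this
    linarith
  decrease_of_full_step s v h1 h2 := by
    obtain ⟨c, hc, hd⟩ := hγ.hasDerivAt_vertexArea_right hR h1 h2
    -- The `centerForm` terms cancel and leave the slope `(R * k - 1) * (c - R) < 0`.
    have h := (hd.hasDerivWithinAt.fun_add (hγ.hasDerivWithinAt_vertexArea_add hR v)).eventually_lt
      (by nlinarith [hγ.one_lt_mul hR v])
    have h3 : ∀ᶠ u in nhdsWithin v (Set.Ioi v), u ∈ Set.Ioo v (s + L) := Ioo_mem_nhdsGT h2
    have h4 : ∀ᶠ u in nhdsWithin v (Set.Ioi v), u ∈ Set.Ioo v (v + L) :=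
      Ioo_mem_nhdsGT (by linarith)
    obtain ⟨u, hu, hu3, hu4⟩ := (h.and (h3.and h4)).exists
    exact ⟨u, hu3.1, hu3.2.le, hu4.2.le, hu⟩
  decrease_of_ne s v y x h1 h2 h3 h4 h5 := by
    obtain ⟨c, hc, hd⟩ := hγ.hasDerivAt_vertexArea_right hR h1 h2
    have hμ := hγ.one_lt_mul hR v
    obtain ⟨e, he, hex⟩ : ∃ e, vertexCos γ R v y < e ∧
        HasDerivWithinAt (fun u => vertexArea γ R u x)
          (centerForm γ R v - (R * curvature γ v - 1) * e) (Set.Ioi v) v := by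
      rcases h5.lt_or_eq with h5 | rfl
      · exact ⟨_, hγ.strictMonoOn_vertexCos hR v ⟨h3, by linarith⟩ ⟨by linarith, h5⟩ h4,
          (hγ.hasDerivAt_vertexArea_left hR (by linarith) h5).hasDerivWithinAt⟩
      · exact ⟨R, hγ.vertexCos_lt hR h3 h4, hγ.hasDerivWithinAt_vertexArea_add hR v⟩
    -- The slopes at `v` are `(R * k - 1) * (c - e)` towards `x` and `(R * k - 1) * (c - vertexCos γ
    -- R v y)` towards `y`. Either the first is negative and `v` moves right, or the second is
    -- positive and `v` moves left.
    rcases lt_or_ge c e with hce | hce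
    · left
      have h := (hd.hasDerivWithinAt.fun_add hex).eventually_lt (by nlinarith)
      have h6 : ∀ᶠ u in nhdsWithin v (Set.Ioi v), u ∈ Set.Ioo v (s + L) := Ioo_mem_nhdsGT h2
      have h7 : ∀ᶠ u in nhdsWithin v (Set.Ioi v), u ∈ Set.Ioo v x := Ioo_mem_nhdsGT (by linarith)
      obtain ⟨u, hu, hu6, hu7⟩ := (h.and (h6.and h7)).exists
      exact ⟨u, hu6.1, hu6.2.le, hu7.2.le, hu⟩
    · right
      have h := (hd.fun_add (hγ.hasDerivAt_vertexArea_left hR h3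
        (by linarith))).eventually_lt_left (by nlinarith)
      have h6 : ∀ᶠ u in nhdsWithin v (Set.Iio v), u ∈ Set.Ioo s v := Ioo_mem_nhdsLT h1
      have h7 : ∀ᶠ u in nhdsWithin v (Set.Iio v), u ∈ Set.Ioo (y - L) v :=
        Ioo_mem_nhdsLT (by linarith)
      obtain ⟨u, hu, hu6, hu7⟩ := (h.and (h6.and h7)).exists
      exact ⟨u, hu6.1, hu6.2, by linarith [hu7.1], hu⟩

end Oval

/-! ### Existence and uniqueness of vertices -/

section Vertex

theorem between_of_sin_lt_sin {α β : ℝ} (h0 : 0 < β) (h1 : β < Real.pi / 2)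
    (h2 : -Real.pi < α) (h3 : α ≤ Real.pi) (h : Real.sin β < Real.sin α) :
    β < α ∧ α < Real.pi - β := by
  have hβ : 0 < Real.sin β := Real.sin_pos_of_pos_of_lt_pi h0 (by linarith)
  have h4 : 0 < α := by
    by_contra! h'
    linarith [Real.sin_nonpos_of_nonpos_of_neg_pi_le h' h2.le]
  constructor
  · by_contra! h'
    linarith [Real.sin_le_sin_of_le_of_le_pi_div_two (by linarith) h1.le h']
  · by_contra! h'
    rw [← Real.sin_pi_sub α] at h
    linarith [Real.sin_le_sin_of_le_of_le_pi_div_two (x := Real.pi - α) (y := β) (by linarith)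
      h1.le (by linarith)]

/-- Two circles meet twice: `α' - b` is `β` or `π - β`. The second value would make `b` negative. -/
theorem eq_of_cos_eq_of_sin_sub_sin {α α' β a b : ℝ} (h0 : 0 < β) (hα : β < α)
    (hα2 : α < Real.pi - β) (hα' : β < α') (hα2' : α' < Real.pi - β)
    (ha : a ∈ Set.Ioc 0 Real.pi) (hb : b ∈ Set.Ioc 0 Real.pi)
    (hcos : Real.cos (a - α) = Real.cos (α' - b))
    (hsin : Real.sin (α' - b) - Real.sin (a - α) = 2 * Real.sin β) :
    a = α - β ∧ b = α' - β := by
  have hβ : 0 < Real.sin β := Real.sin_pos_of_pos_of_lt_pi h0 (by linarith)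
  obtain ⟨ha1, ha2⟩ := ha
  obtain ⟨hb1, hb2⟩ := hb
  have hx : |a - α| < Real.pi := abs_lt.2 ⟨by linarith, by linarith⟩
  have hy : |α' - b| < Real.pi := abs_lt.2 ⟨by linarith, by linarith⟩
  have habs : |a - α| = |α' - b| := Real.injOn_cos ⟨abs_nonneg _, hx.le⟩ ⟨abs_nonneg _, hy.le⟩
    (by rw [Real.cos_abs, Real.cos_abs, hcos])
  rcases abs_eq_abs.1 habs with h | h
  · rw [h] at hsin; linarith
  · rw [h, Real.sin_neg] at hsin
    have h2 : Real.sin (α' - b) = Real.sin β := by linarith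
    have hpos : 0 < α' - b := by
      by_contra! h'
      linarith [Real.sin_nonpos_of_nonpos_of_neg_pi_le h' (by linarith)]
    have h4 : α' - b = β := by
      rcases lt_trichotomy (α' - b) β with h' | h' | h'
      · have := Real.sin_lt_sin_of_lt_of_le_pi_div_two (by linarith) (by linarith) h'
        linarith
      · exact h'
      · have h5 : β < Real.pi - (α' - b) := by linarith
        rw [← Real.sin_pi_sub (α' - b)] at h2
        rcases le_or_gt (α' - b) (Real.pi / 2) with h6 | h6
        · have := Real.sin_lt_sin_of_lt_of_le_pi_div_two (by linarith) h6 h'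
          rw [Real.sin_pi_sub] at h2
          linarith
        · have := Real.sin_lt_sin_of_lt_of_le_pi_div_two (by linarith) (by linarith) h5
          linarith
    constructor <;> linarith

end Vertex

section Oval

variable {γ : ℝ → ℂ} {L R : ℝ}

theorem larmorPoint_eq (γ : ℝ → ℂ) (R s φ : ℝ) : larmorPoint γ R s φ =
    larmorCenter γ R s - R * Complex.I * (deriv γ s * Complex.exp (φ * Complex.I)) := by
  simp only [larmorPoint, larmorCenter]; ring

theorem IsOval.larmorPoint_add (hγ : IsOval γ L) (R s φ : ℝ) (n : ℕ) :
    larmorPoint γ R (s + n * L) φ = larmorPoint γ R s φ := by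
  have h1 : Function.Periodic (larmorCenter γ R) L := hγ.larmorCenter_add R
  simp only [larmorPoint, h1.nat_mul n s, hγ.periodic.nat_mul n s]

/-- Existence, uniqueness and area contribution of the vertex between the sides tangent at `γ s`
and `γ t`. -/
theorem IsOval.exists_vertex (hγ : IsOval γ L) (hR : ∀ s, (curvature γ s)⁻¹ < R) {s t : ℝ}
    (h1 : s < t) (h2 : t ≤ s + L) :
    ∃ a b, a ∈ Set.Ioc 0 Real.pi ∧ b ∈ Set.Ioc 0 Real.pi ∧
      larmorPoint γ R s a = larmorPoint γ R t (-b) ∧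
      (∀ a' ∈ Set.Ioc 0 Real.pi, ∀ b' ∈ Set.Ioc 0 Real.pi,
        larmorPoint γ R s a' = larmorPoint γ R t (-b') → a' = a ∧ b' = b) ∧
      R ^ 2 / 2 * (a + b) + 1 / 2 * cross (larmorCenter γ R s - larmorCenter γ R t)
        (larmorPoint γ R s a) = vertexArea γ R s t := by
  have hRp := hγ.radius_pos hR
  have hpi := Real.pi_pos
  rcases h2.lt_or_eq with h2 | rfl
  · have hpos := hγ.chord_pos hR h1 h2
    have hleft := hγ.chord_lt_left hR h1 h2
    have hright := hγ.chord_lt_right hR h1 h2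
    have hlt := hγ.chord_lt hR h1 h2
    have hTs := hγ.dot_tangent_self s
    set D := larmorCenter γ R t - larmorCenter γ R s with hD
    set r := ‖D‖ with hr
    have hrr : r ^ 2 = dot D D := (dot_self_eq D).symm
    rw [← hrr] at hpos hleft hright hlt
    have hr0 : 0 < r := lt_of_le_of_ne (norm_nonneg D) fun h => by
      rw [← h] at hpos; norm_num at hpos
    have hrC : (r : ℂ) ≠ 0 := by exact_mod_cast hr0.ne'
    obtain ⟨u, hun, hDu⟩ : ∃ u : ℂ, ‖u‖ = 1 ∧ D = r * u := by
      refine ⟨D / r, ?_, by field_simp⟩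
      rw [norm_div, Complex.norm_real, Real.norm_of_nonneg hr0.le, ← hr, div_self hr0.ne']
    have hu1 : dot u u = 1 := by rw [dot_self_eq, hun, one_pow]
    set β := Real.arcsin (r / (2 * R)) with hβ
    have hr2 : r < 2 * R := by nlinarith
    have hsβ : Real.sin β = r / (2 * R) := Real.sin_arcsin
      (by have : 0 < r / (2 * R) := by positivity
          linarith) (by rw [div_le_one (by positivity)]; exact hr2.le)
    have hβ0 : 0 < β := Real.arcsin_pos.2 (by positivity)
    have hβ1 : β < Real.pi / 2 := Real.arcsin_lt_pi_div_two.2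
      (by rw [div_lt_one (by positivity)]; exact hr2)
    have hcβ : √(R ^ 2 - r ^ 2 / 4) = R * Real.cos β := by
      rw [hβ, Real.cos_arcsin, show R ^ 2 - r ^ 2 / 4 = R ^ 2 * (1 - (r / (2 * R)) ^ 2) by
        field_simp; ring, Real.sqrt_mul (by positivity), Real.sqrt_sq hRp.le]
    -- The left normal to the line of centers is met on `C_s` at angle `α` after tangency and on
    -- `C_t` at angle `α'` before it. The vertex lies off these normals by `β`, where `R * sin β = r
    -- / 2`.
    set α := (-(u * (starRingEnd ℂ) (deriv γ s))).arg with hα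
    set α' := (-(deriv γ t * (starRingEnd ℂ) u)).arg with hα'
    have hn : ‖-(u * (starRingEnd ℂ) (deriv γ s))‖ = 1 := by
      rw [norm_neg, norm_mul, hun, Complex.norm_conj, hγ.unit_speed, one_mul]
    have hn' : ‖-(deriv γ t * (starRingEnd ℂ) u)‖ = 1 := by
      rw [norm_neg, norm_mul, Complex.norm_conj, hun, hγ.unit_speed, one_mul]
    have heα : Complex.exp (α * Complex.I) = -(u * (starRingEnd ℂ) (deriv γ s)) := by
      have := Complex.norm_mul_exp_arg_mul_I (-(u * (starRingEnd ℂ) (deriv γ s)))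
      rwa [hn, Complex.ofReal_one, one_mul] at this
    have heα' : Complex.exp (α' * Complex.I) = -(deriv γ t * (starRingEnd ℂ) u) := by
      have := Complex.norm_mul_exp_arg_mul_I (-(deriv γ t * (starRingEnd ℂ) u))
      rwa [hn', Complex.ofReal_one, one_mul] at this
    have hconj : ∀ z : ℂ, dot z z = 1 → z * (starRingEnd ℂ) z = 1 := fun z hz => by
      rw [Complex.mul_conj, Complex.normSq_apply]
      exact_mod_cast hz
    obtain ⟨h3, h4⟩ := between_of_sin_lt_sin hβ0 hβ1 (Complex.neg_pi_lt_arg _)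
      (Complex.arg_le_pi _) (show Real.sin β < Real.sin α by
        rw [hα, Complex.sin_arg, hn, div_one, hsβ, div_lt_iff₀ (by positivity)]
        rw [hDu] at hleft
        refine lt_of_mul_lt_mul_left (hleft.trans_eq' ?_ |>.trans_eq ?_) hr0.le
        · ring
        · simp [cross]; ring)
    obtain ⟨h3', h4'⟩ := between_of_sin_lt_sin hβ0 hβ1 (Complex.neg_pi_lt_arg _)
      (Complex.arg_le_pi _) (show Real.sin β < Real.sin α' by
        rw [hα', Complex.sin_arg, hn', div_one, hsβ, div_lt_iff₀ (by positivity)]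
        rw [hDu] at hright
        refine lt_of_mul_lt_mul_left (hright.trans_eq' ?_ |>.trans_eq ?_) hr0.le
        · ring
        · simp [cross]; ring)
    -- Multiplying exponentials gives congruence modulo `2π`, and both sides lie in `(0, 2π)`.
    have hsum : α + α' = tangentAngle γ t - tangentAngle γ s := by
      have h : Complex.exp ((α + α' : ℝ) * Complex.I) =
          Complex.exp ((tangentAngle γ t - tangentAngle γ s : ℝ) * Complex.I) := by
        push_cast
        rw [add_mul, sub_mul, Complex.exp_add, Complex.exp_sub, heα, heα', ← hγ.tangent_eq,
          ← hγ.tangent_eq, eq_div_iff (by rw [hγ.tangent_eq]; exact Complex.exp_ne_zero _)]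
        linear_combination deriv γ t * (u * (starRingEnd ℂ) u) * hconj _ hTs +
          deriv γ t * hconj _ hu1
      rw [Complex.exp_eq_exp_iff_exists_int] at h
      obtain ⟨n, hn⟩ := h
      have hn' : α + α' = tangentAngle γ t - tangentAngle γ s + n * (2 * Real.pi) := by
        have h1 : ((α + α' : ℝ) : ℂ) * Complex.I =
            ((tangentAngle γ t - tangentAngle γ s + n * (2 * Real.pi) : ℝ) : ℂ) * Complex.I := by
          rw [hn]; push_cast; ring
        exact_mod_cast mul_right_cancel₀ Complex.I_ne_zero h1
      have h5 := hγ.strictMono_tangentAngle h1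
      have h6 := hγ.strictMono_tangentAngle h2
      rw [hγ.tangentAngle_add] at h6
      have h7 : (-1 : ℝ) < n := by by_contra! h; nlinarith
      have h8 : (n : ℝ) < 1 := by by_contra! h; nlinarith
      have h7' : -1 < n := by exact_mod_cast h7
      have h8' : n < 1 := by exact_mod_cast h8
      obtain rfl : n = 0 := by omega
      simpa using hn'
    have hps : ∀ a : ℝ, larmorPoint γ R s a = larmorCenter γ R s +
        R * Complex.I * (u * Complex.exp ((a - α : ℝ) * Complex.I)) := fun a => by
      have e : Complex.exp (a * Complex.I) =
          Complex.exp ((a - α : ℝ) * Complex.I) * Complex.exp (α * Complex.I) := by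
        rw [← Complex.exp_add]; congr 1; push_cast; ring
      rw [larmorPoint_eq, e, heα]
      linear_combination R * Complex.I * u * Complex.exp ((a - α : ℝ) * Complex.I) * hconj _ hTs
    have hpt : ∀ b : ℝ, larmorPoint γ R t (-b) = larmorCenter γ R t +
        R * Complex.I * (u * Complex.exp ((α' - b : ℝ) * Complex.I)) := fun b => by
      have e : Complex.exp ((α' - b : ℝ) * Complex.I) =
          Complex.exp (α' * Complex.I) * Complex.exp ((-b : ℝ) * Complex.I) := by
        rw [← Complex.exp_add]; congr 1; push_cast; ring
      rw [larmorPoint_eq, e, heα']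
      linear_combination R * Complex.I * deriv γ t * Complex.exp ((-b : ℝ) * Complex.I) *
        hconj _ hu1
    have hiff : ∀ a b : ℝ, larmorPoint γ R s a = larmorPoint γ R t (-b) ↔
        Real.cos (a - α) = Real.cos (α' - b) ∧
          Real.sin (α' - b) - Real.sin (a - α) = 2 * Real.sin β := fun a b => by
      have hu0 : u ≠ 0 := fun h => by rw [h, norm_zero] at hun; exact zero_ne_one hun
      have e1 : larmorPoint γ R s a - larmorPoint γ R t (-b) =
          u * (R * (Complex.I * (Complex.exp ((a - α : ℝ) * Complex.I) -
            Complex.exp ((α' - b : ℝ) * Complex.I))) - r) := by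
        rw [hps, hpt]
        linear_combination -hDu + hD
      rw [← sub_eq_zero, e1, mul_eq_zero, or_iff_right hu0, Complex.ext_iff, hsβ]
      simp only [Complex.sub_re, Complex.sub_im, Complex.re_ofReal_mul, Complex.im_ofReal_mul,
        Complex.I_mul_re, Complex.I_mul_im, Complex.exp_ofReal_mul_I_re,
        Complex.exp_ofReal_mul_I_im, Complex.ofReal_re, Complex.ofReal_im, Complex.zero_re,
        Complex.zero_im]
      constructor
      · rintro ⟨h5, h6⟩
        refine ⟨?_, ?_⟩
        · have := (mul_eq_zero.1 (sub_eq_zero.1 h6)).resolve_left hRp.ne'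
          linarith
        · field_simp; linarith
      · rintro ⟨h5, h6⟩
        field_simp at h6
        refine ⟨by linarith, by rw [h5]; ring⟩
    refine ⟨α - β, α' - β, ⟨by linarith, by linarith⟩, ⟨by linarith, by linarith⟩, ?_, ?_, ?_⟩
    · rw [hiff]
      constructor
      · rw [show α - β - α = -β by ring, show α' - (α' - β) = β by ring, Real.cos_neg]
      · rw [show α - β - α = -β by ring, show α' - (α' - β) = β by ring, Real.sin_neg]; ring
    · intro a ha b hb h
      obtain ⟨h5, h6⟩ := (hiff a b).1 h
      exact eq_of_cos_eq_of_sin_sub_sin hβ0 h3 h4 h3' h4' ha hb h5 h6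
    · have h5 : larmorPoint γ R s (α - β) = larmorCenter γ R s +
          (R * Complex.I) * (u * (Real.cos β - Real.sin β * Complex.I)) := by
        rw [hps, show α - β - α = -β by ring, Complex.exp_mul_I, ← Complex.ofReal_cos,
          ← Complex.ofReal_sin, Real.cos_neg, Real.sin_neg]
        push_cast; ring
      have h6 : larmorCenter γ R t = larmorCenter γ R s + r * u := by rw [← hDu, hD]; ring
      rw [vertexArea, ← hD, ← hr, stripArea, hcβ, ← hβ, ← hsum, h5, h6]
      have h7 : Real.sin β * (2 * R) = r := by rw [hsβ]; field_simp
      simp only [dot] at hu1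
      generalize Real.sin β = y at *
      generalize Real.cos β = x at *
      simp [cross]
      linear_combination (-(r * R * x / 2)) * hu1
  -- A full step: the circles coincide, so `a + b` is a positive multiple of `2π`, which forces `a =
  -- b = π`.
  · have hΓ := hγ.larmorCenter_add R s
    have hT := hγ.tangent_add s
    refine ⟨Real.pi, Real.pi, ⟨hpi, le_rfl⟩, ⟨hpi, le_rfl⟩, ?_, ?_, ?_⟩
    · rw [larmorPoint_eq, larmorPoint_eq, hΓ, hT]
      simp [Complex.exp_neg]
    · intro a ha b hb h
      rw [larmorPoint_eq, larmorPoint_eq, hΓ, hT] at h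
      have hT0 : deriv γ s ≠ 0 := fun h0 => by
        have := hγ.unit_speed s
        rw [h0, norm_zero] at this; exact zero_ne_one this
      have hRC : (R : ℂ) * Complex.I ≠ 0 :=
        mul_ne_zero (by exact_mod_cast hRp.ne') Complex.I_ne_zero
      have h3 := mul_left_cancel₀ hT0 (mul_left_cancel₀ hRC (sub_right_injective h))
      have hcos : Real.cos (a + b) = 1 := by
        have h4 : Complex.exp ((a + b : ℝ) * Complex.I) = 1 := by
          push_cast
          rw [add_mul, Complex.exp_add, h3, ← Complex.exp_add]
          simp
        rw [← Complex.exp_ofReal_mul_I_re, h4, Complex.one_re]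
      obtain ⟨n, hn⟩ := (Real.cos_eq_one_iff _).1 hcos
      have h0 : (0 : ℝ) < n := by by_contra! h'; nlinarith [ha.1, hb.1]
      have h1 : (1 : ℝ) ≤ n := by
        have : 0 < n := by exact_mod_cast h0
        exact_mod_cast this
      constructor <;> nlinarith [ha.2, hb.2]
    · simp [vertexArea, cross, stripArea, hΓ, hγ.tangentAngle_add]
      ring

end Oval

/-! ### Polygons as cycles -/

section Polygon

variable {γ : ℝ → ℂ} {L R : ℝ} {p q : ℕ}

theorem hasDerivAt_larmorPoint (γ : ℝ → ℂ) (R s φ : ℝ) :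
    HasDerivAt (larmorPoint γ R s)
      (Complex.exp (φ * Complex.I) * Complex.I * (γ s - larmorCenter γ R s)) φ := by
  have h := (((hasDerivAt_id φ).ofReal_comp.mul_const Complex.I).cexp.mul_const
    (γ s - larmorCenter γ R s)).const_add (larmorCenter γ R s)
  refine h.congr_deriv ?_
  simp

theorem IsOval.integral_side (hγ : IsOval γ L) (R s a b : ℝ) :
    ∫ φ in (-b)..a, (1 / 2) * cross (larmorPoint γ R s φ) (deriv (larmorPoint γ R s) φ) =
      R ^ 2 / 2 * (a + b) + 1 / 2 * cross (larmorCenter γ R s)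
        (larmorPoint γ R s a - larmorPoint γ R s (-b)) := by
  have hd : ∀ φ, HasDerivAt (fun φ => R ^ 2 / 2 * φ +
      1 / 2 * cross (larmorCenter γ R s) (larmorPoint γ R s φ))
      ((1 / 2) * cross (larmorPoint γ R s φ) (deriv (larmorPoint γ R s) φ)) φ := fun φ => by
    have h1 := hasDerivAt_larmorPoint γ R s φ
    refine (((hasDerivAt_id φ).const_mul (R ^ 2 / 2)).add
      (((hasDerivAt_const φ (larmorCenter γ R s)).cross h1).const_mul (1 / 2))).congr_deriv ?_
    have hT := hγ.dot_tangent_self s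
    have hγs : γ s - larmorCenter γ R s = -R * (Complex.I * deriv γ s) := by
      simp [larmorCenter]
    rw [h1.deriv, larmorPoint, hγs]
    simp only [cross, dot, Complex.mul_re, Complex.mul_im, Complex.add_re, Complex.add_im,
      Complex.exp_ofReal_mul_I_re, Complex.exp_ofReal_mul_I_im, Complex.I_re, Complex.I_im,
      Complex.neg_re, Complex.neg_im, Complex.ofReal_re, Complex.ofReal_im, Complex.zero_re,
      Complex.zero_im] at *
    linear_combination (-(R ^ 2) / 2) * hT - (R ^ 2 / 2) * ((deriv γ s).re * (deriv γ s).re +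
      (deriv γ s).im * (deriv γ s).im) * Real.sin_sq_add_cos_sq φ
  have hderiv : deriv (larmorPoint γ R s) =
      fun φ : ℝ => Complex.exp (φ * Complex.I) * Complex.I * (γ s - larmorCenter γ R s) :=
    funext fun φ => (hasDerivAt_larmorPoint γ R s φ).deriv
  have hc : Continuous fun φ : ℝ =>
      (1 / 2) * cross (larmorPoint γ R s φ) (deriv (larmorPoint γ R s) φ) := by
    rw [hderiv]
    unfold cross larmorPoint
    fun_prop
  rw [intervalIntegral.integral_eq_sub_of_hasDerivAt (fun φ _ => hd φ)
    (hc.intervalIntegrable _ _)]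
  simp only [cross, Complex.sub_re, Complex.sub_im]
  ring

theorem CircumscribedPolygon.isCycle (P : CircumscribedPolygon γ L R p q) : IsCycle L p q P.s :=
  ⟨fun j => ⟨(P.s_lt j).le, P.s_le j⟩, P.s_add⟩

theorem CircumscribedPolygon.area_eq (hγ : IsOval γ L) (hR : ∀ s, (curvature γ s)⁻¹ < R)
    (P : CircumscribedPolygon γ L R p q) : P.area = cycleCost (vertexArea γ R) q P.s := by
  have h1 : ∀ i, larmorPoint γ R (P.s (i + q)) = larmorPoint γ R (P.s i) := fun i => by
    funext φ; rw [P.s_add, hγ.larmorPoint_add]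
  have h2 : ∀ i, larmorCenter γ R (P.s (i + q)) = larmorCenter γ R (P.s i) := fun i => by
    have : Function.Periodic (larmorCenter γ R) L := hγ.larmorCenter_add R
    rw [P.s_add, this.nat_mul]
  -- `g i` is the contribution of the beginning of side `i`; a cyclic shift by one assigns it to the
  -- vertex that precedes that side.
  set g : ℕ → ℝ := fun i => R ^ 2 / 2 * P.b i -
    1 / 2 * cross (larmorCenter γ R (P.s i)) (larmorPoint γ R (P.s i) (-P.b i)) with hg
  have hsum := sum_range_add_periodic (f := g) (m := q)
    (fun i => by simp only [hg, h1, h2, P.b_add]) 1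
  have h3 : P.area = ∑ i ∈ Finset.range q, (R ^ 2 / 2 * P.a i +
      1 / 2 * cross (larmorCenter γ R (P.s i)) (larmorPoint γ R (P.s i) (P.a i)) + g i) := by
    refine Finset.sum_congr rfl fun i _ => ?_
    rw [hγ.integral_side]
    simp only [hg, cross, Complex.sub_re, Complex.sub_im]
    ring
  rw [h3, Finset.sum_add_distrib, ← hsum, ← Finset.sum_add_distrib]
  refine Finset.sum_congr rfl fun i _ => ?_
  obtain ⟨a, b, -, -, -, huniq, harea⟩ := hγ.exists_vertex hR (P.s_lt i) (P.s_le i)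
  obtain ⟨rfl, rfl⟩ := huniq _ (P.a_mem i) _ (P.b_mem (i + 1)) (P.vertex i)
  rw [← harea]
  simp only [hg]
  rw [← P.vertex i]
  simp only [cross, Complex.sub_re, Complex.sub_im]
  ring

theorem IsOval.exists_circumscribedPolygon (hγ : IsOval γ L) (hR : ∀ s, (curvature γ s)⁻¹ < R)
    (hq : 0 < q) {v : ℕ → ℝ} (hv : IsCycle L p q v) (hlt : ∀ j, v j < v (j + 1)) :
    ∃ P : CircumscribedPolygon γ L R p q, P.s = v := by
  have h := fun j => hγ.exists_vertex hR (hlt j) (hv.1 j).2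
  choose a b ha hb hab huniq _ using h
  have hper : ∀ j, a (j + q) = a j ∧ b (j + q) = b j := fun j => by
    refine huniq j _ (ha _) _ (hb _) ?_
    have h1 := hab (j + q)
    rwa [hv.2, add_right_comm, hv.2, hγ.larmorPoint_add, hγ.larmorPoint_add] at h1
  have hb' : ∀ i, b (i + 1 + (q - 1)) = b i := fun i => by
    rw [show i + 1 + (q - 1) = i + q by omega, (hper i).2]
  exact ⟨{
    s := v
    a := a
    -- The vertex after side `j` fixes the backward angle of side `j + 1`; by periodicity `i + (q -
    -- 1)` stands for `i - 1`.
    b := fun i => b (i + (q - 1))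
    s_lt := hlt
    s_le := fun i => (hv.1 i).2
    s_add := hv.2
    a_mem := ha
    b_mem := fun i => hb _
    a_add := fun i => (hper i).1
    b_add := fun i => by rw [add_right_comm, (hper _).2]
    vertex := fun i => by rw [hb']; exact hab i }, rfl⟩

theorem IsMinCycle.isLeast_circumscribedAreas (hγ : IsOval γ L)
    (hR : ∀ s, (curvature γ s)⁻¹ < R) (hp : 1 ≤ p) (hpq : p ≤ q) {v : ℕ → ℝ}
    (hv : IsMinCycle (vertexArea γ R) L p q v) :
    IsLeast (circumscribedAreas γ L R p q) (cycleCost (vertexArea γ R) q v) := by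
  refine ⟨?_, ?_⟩
  · obtain ⟨P, rfl⟩ := hγ.exists_circumscribedPolygon hR (by omega) hv.1
      (hv.lt_succ (hγ.isTwistCost_vertexArea hR) hp hpq)
    exact ⟨P, P.area_eq hγ hR⟩
  · rintro _ ⟨P, rfl⟩
    simp only [P.area_eq hγ hR]
    exact hv.2 _ P.isCycle

end Polygon

end

theorem mainTheorem11 (γ : ℝ → ℂ) (L R : ℝ) (hγ : IsOval γ L)
    (hR : ∀ s, (curvature γ s)⁻¹ < R) (p q : ℕ) (hp : 1 ≤ p) (hpq : p < q) :
    (∀ m, p ≤ m →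
      IsLeast (circumscribedAreas γ L R p m) (minCircumscribedArea γ L R p m)) ∧
    minCircumscribedArea γ L R p (q - 1) + minCircumscribedArea γ L R p (q + 1) >
      2 * minCircumscribedArea γ L R p q := by
  have hH := hγ.isTwistCost_vertexArea hR
  have key : ∀ m, p ≤ m → ∃ v, IsMinCycle (vertexArea γ R) L p m v ∧
      minCircumscribedArea γ L R p m = cycleCost (vertexArea γ R) m v ∧
      IsLeast (circumscribedAreas γ L R p m) (minCircumscribedArea γ L R p m) := fun m hm => by
    obtain ⟨v, hv⟩ := exists_isMinCycle hH hp hm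
    have h := hv.isLeast_circumscribedAreas hγ hR hp hm
    have h' : minCircumscribedArea γ L R p m = cycleCost (vertexArea γ R) m v := h.csInf_eq
    exact ⟨v, hv, h', h' ▸ h⟩
  refine ⟨fun m hm => (key m hm).choose_spec.2.2, ?_⟩
  obtain ⟨x, hx, hx', -⟩ := key (q - 1) (by omega)
  obtain ⟨y, hy, hy', -⟩ := key (q + 1) (by omega)
  obtain ⟨v, hv, hv', -⟩ := key q hpq.le
  rw [hx', hy', hv']
  exact hH.two_mul_min_lt hp hpq hx hy hv
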